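/- Let $0<q<1$. Write $(a;q)_n=\prod_{k=0}^{n-1}(1-aq^k)$ for $0\le n\le\infty$, $\binom{n}{k}_q=\frac{(q;q)_n}{(q;q)_k(q;q)_{n-k}}$, $$A_q(w)=\sum_{k\ge0}\frac{q^{k^2}}{(q;q)_k}(-w)^k,\qquad B_q(w)=\sum_{k\ge0}\frac{q^{k^2}w^k}{(q;q)_k},\qquad \Theta(w|q)=\sum_{k\in\mathbb Z}q^{k^2}w^k\ (w\neq0).$$ The Ismail–Masson polynomials are given by $h_n(\sinh\xi|q)=\sum_{k=0}^n\binom nk_q q^{k(k-n)}(-1)^ke^{(n-2k)\xi}$. For real $\theta$ put $\mathbb S(\theta)=\{\{n\theta\}:n\in\mathbb N\}$, where $\{x\}=x-\lfloor x\rfloor$, and for $m\in\mathbb Z$ put $\chi(m)=m-2\lfloor m/2\rfloor$. For real $\theta_j,\beta_j$ let $\omega(\theta_1,\dots,\theta_N|\beta_1,\dots,\beta_N)\in[-\infty,\infty]$ be the least upper bound of the real numbers $r$ for which there are infinitely many integers $n,m_1,\dots,m_N$ with $n>0$ and $|n\theta_j-\beta_j-m_j|<n^{-(r-1)}$ for $j=1,\dots,N$.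 **Theorem 3.1.** Let $z\in\mathbb C\setminus\{0\}$, $\tau,\theta\in\mathbb R$, $s=\frac{1+\tau}2+\frac{i\theta\pi}{\log q}$ and $\sinh\xi_n=\frac{q^{-ns}z-q^{ns}z^{-1}}2$. Below, "for $n$ sufficiently large" means for all $n$ of the kind described with $n\ge n_0$, where $n_0$ may depend on all the other parameters ($q,z,\tau,\theta,\lambda,\lambda_1,\beta,\beta_1,\beta_2,\rho$, as far as they occur) but not on $m$, $m_1$, $\gamma_n$, $a_n$, $b_n$. Put $$C=\frac{(-q^3;q)_\infty B_q(|z|^{-2})}{(1-q)(q;q)_\infty},\quad D=\frac{(-q^3;q)_\infty^2\,\Theta(|z|^2|\sqrt q)}{(1-q)^2(q;q)_\infty},\quad \nu_n=\left\lfloor\frac{q^4\log^2n}{1+\log q^{-1}}\right\rfloor,$$ $$E_n(\rho)=62D\left\{|z|^{2\nu_n}q^{\nu_n^2}+\frac{q^{\nu_n^2/2}}{|z|^{2\nu_n}}+\frac{\log^2n}{n^\rho}\right\},\quad P_n(m,w)=\frac{z^nq^{-n^2s+\lfloor m/2\rfloor(\tau n+\lfloor m/2\rfloor)}}{(q;q)_\infty\,w^{\lfloor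 m/2\rfloor}}.$$ 1. If $\tau>0$, then for every $n\geq 0$, $\displaystyle\frac{h_n(\sinh\xi_n|q)}{z^nq^{-n^2s}}=1+r_n$ with $\displaystyle|r_n|\le\frac{qB_q(q^2|z|^{-2})}{(1-q)|z|^2}q^{n\tau}$. 2. If $\tau=0$ and $\theta$ is rational, then for every $\lambda\in\mathbb S(\theta)$ there are infinitely many pairs of integers $n>0$ and $m$ with $n\theta=m+\lambda$, $\lambda=\{n\theta\}$, and for such $n$ sufficiently large $$\frac{h_n(\sinh\xi_n|q)}{z^nq^{-n^2/2}e^{-n^2\theta\pi i}}=A_q\!\left(\frac{e^{2\lambda\pi i}}{z^2}\right)+r_n,\qquad |r_n|\le3C\left\{q^{n/2}+\frac{q^{n^2/4}}{|z|^{2\lfloor n/2\rfloor}}\right\}.$$ 3. If $\tau=0$ and $\theta$ is irrational, then for all real $\beta$ and $\rho$ with $0<\rho<\omega(\theta|\beta)-1$ there are infinitely many pairs of integers $n>0$ and $m$ with $n\theta=m+\beta+\gamma_n$, $|\gamma_n|\le n^{-\rho}$, and for such $n$ sufficiently large $$\frac{h_n(\sinh\xi_n|q)}{z^nq^{-n^2/2}e^{-n^2\theta\pi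 i}}=A_q\!\left(\frac{e^{2\pi i\beta}}{z^2}\right)+r_n,\qquad |r_n|\le48C\left\{\frac{\log^2n}{n^\rho}+\frac{q^{\nu_n^2}}{|z|^{2\nu_n}}\right\}.$$ 4. Let $-1<\tau<0$ with $\tau$ and $\theta$ rational. Let $\lambda\in\mathbb S(-\tau)$ and $\lambda_1\in\mathbb S(\theta)$ be such that for infinitely many positive integers $n$ there are integers $m,m_1$ with $-n\tau=m+\lambda$, $m=\lfloor-\tau n\rfloor$, $\lambda=\{-\tau n\}$ and $n\theta=m_1+\lambda_1$, $\lambda_1=\{n\theta\}$. Then for such $n$ sufficiently large $$h_n(\sinh\xi_n|q)=P_n(m,-z^2e^{-2\pi i\lambda_1})\left\{\Theta(-z^2q^{\chi(m)+\lambda}e^{-2\pi i\lambda_1}|q)+r_n\right\},$$ $$|r_n|\le14D\left\{q^{\mu_n}+q^{\mu_n^2}|z|^{2\mu_n}+\frac{q^{\mu_n^2/2}}{|z|^{2\mu_n}}\right\},\qquad \mu_n=\min\left\{\left\lfloor\tfrac{(1+\tau)n}4\right\rfloor,\left\lfloor\tfrac{-\tau n}4\right\rfloor\right\}.$$ 5.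 Let $-1<\tau<0$ with $\tau$ rational and $\theta$ irrational, let $\beta\in[0,1)$ and $0<\rho<\omega(\theta|\beta)-1$. Then for some $\lambda\in\mathbb S(-\tau)$ there are infinitely many positive integers $n$ for which there are integers $m,m_1$ with $n\theta=m_1+\beta+b_n$, $|b_n|\le n^{-\rho}$, $-n\tau=m+\lambda$, $m=\lfloor-n\tau\rfloor$. For every $\lambda\in\mathbb S(-\tau)$ and all such $n,m$ with $n$ sufficiently large $$h_n(\sinh\xi_n|q)=P_n(m,-z^2e^{-2n\theta\pi i})\left\{\Theta(-z^2q^{\chi(m)+\lambda}e^{-2\beta\pi i}|q)+r_n\right\},\qquad|r_n|\le E_n(\rho).$$ 6. Let $-1<\tau<0$ with $\tau$ irrational and $\theta$ rational, let $\beta\in[0,1)$ and $0<\rho<\omega(-\tau|\beta)-1$. Then for some $\lambda\in\mathbb S(\theta)$ there are infinitely many positive integers $n$ for which there are integers $m,m_1$ with $-n\tau=m+\beta+a_n$, $|a_n|\le n^{-\rho}$, $n\theta=m_1+\lambda$, $\lambda=\{n\theta\}$. For every $\lambda\in\mathbb S(\theta)$ and all such $n,m$ with $n$ sufficiently large $$h_n(\sinh\xi_n|q)=P_n(m,-z^2e^{-2n\theta\pi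 i})\left\{\Theta(-z^2q^{\chi(m)+\beta}e^{-2\lambda\pi i}|q)+r_n\right\},\qquad|r_n|\le E_n(\rho).$$ 7. Let $-1<\tau<0$ with $\tau$ and $\theta$ irrational, and let $\beta_1,\beta_2\in[0,1)$ satisfy $\omega(-\tau,\theta|\beta_1,\beta_2)>1$. Then for every $\rho$ with $0<\rho<\omega(-\tau,\theta|\beta_1,\beta_2)-1$ there are infinitely many positive integers $n$ for which there are integers $m,m_1$ with $-\tau n=m+\beta_1+a_n$, $|a_n|<n^{-\rho}$ and $n\theta=m_1+\beta_2+b_n$, $|b_n|<n^{-\rho}$, and for all such $n,m$ with $n$ sufficiently large $$h_n(\sinh\xi_n|q)=P_n(m,-z^2e^{-2n\theta\pi i})\left\{\Theta(-z^2q^{\chi(m)+\beta_1}e^{-2\beta_2\pi i}|q)+r_n\right\},\qquad|r_n|\le E_n(\rho).$$ -/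

import Mathlib

open Set

noncomputable section

namespace IsmailMasson

section Series

variable {𝕜 : Type*} [NormedField 𝕜]

/-- The finite `q`-shifted factorial `(a; q)_n = ∏_{k < n} (1 - a q ^ k)`. -/
def qPoch (a q : 𝕜) (n : ℕ) : 𝕜 := ∏ k ∈ Finset.range n, (1 - a * q ^ k)

/-- The infinite `q`-shifted factorial `(a; q)_∞ = ∏_{k ≥ 0} (1 - a q ^ k)`. -/
def qPochInf (a q : 𝕜) : 𝕜 := ∏' k : ℕ, (1 - a * q ^ k)

/-- The `q`-binomial coefficient `(q; q)_n / ((q; q)_k (q; q)_{n - k})`, used for `k ≤ n`. -/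
def qBinom (q : 𝕜) (n k : ℕ) : 𝕜 := qPoch q q n / (qPoch q q k * qPoch q q (n - k))

/-- Ramanujan's function `A_q(z) = ∑_{k ≥ 0} q ^ (k ^ 2) (-z) ^ k / (q; q)_k`. -/
def ramanujanA (q z : 𝕜) : 𝕜 := ∑' k : ℕ, q ^ (k ^ 2) / qPoch q q k * (-z) ^ k

/-- The companion function `B_q(z) = ∑_{k ≥ 0} q ^ (k ^ 2) z ^ k / (q; q)_k`. -/
def ramanujanB (q z : 𝕜) : 𝕜 := ∑' k : ℕ, q ^ (k ^ 2) * z ^ k / qPoch q q k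

/-- The theta function `Θ(z | q) = ∑_{n ∈ ℤ} q ^ (n ^ 2) z ^ n`. -/
def theta (z q : 𝕜) : 𝕜 := ∑' n : ℤ, q ^ (n ^ 2) * z ^ n

end Series

/-- The sum `∑_{k = 0}^{n} [n; k]_q q ^ (k (k - n)) (-1) ^ k w ^ (n - 2 k)`, in which `w` plays
the role of `e ^ ξ`. -/
def hermiteSum (q : ℂ) (n : ℕ) (w : ℂ) : ℂ :=
  ∑ k ∈ Finset.range (n + 1),
    qBinom q n k * q ^ ((k : ℤ) * ((k : ℤ) - (n : ℤ))) * (-1) ^ k * w ^ ((n : ℤ) - 2 * (k : ℤ))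

/-- The Ismail–Masson polynomial `h_n(x | q)` as a function of `x`. It is evaluated through one
solution `w = e ^ ξ` of `sinh ξ = x`; by `h_sinh` below the choice of `ξ` does not matter, so that
`h_n(sinh ξ | q) = ∑_{k = 0}^{n} [n; k]_q q ^ (k (k - n)) (-1) ^ k e ^ ((n - 2 k) ξ)` for all `ξ`. -/
def h (q : ℂ) (n : ℕ) (x : ℂ) : ℂ := hermiteSum q n (x + (x ^ 2 + 1) ^ (1 / 2 : ℂ))

theorem hermiteSum_neg_inv (q : ℂ) (n : ℕ) (w : ℂ) :
    hermiteSum q n (-w⁻¹) = hermiteSum q n w := by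
  unfold hermiteSum
  rw [← Finset.sum_range_reflect]
  refine Finset.sum_congr rfl fun k hk => ?_
  have hk' : k ≤ n := by
    have := Finset.mem_range.1 hk
    omega
  obtain ⟨j, rfl⟩ := Nat.exists_eq_add_of_le hk'
  have h1 : k + j + 1 - 1 - k = j := by omega
  rw [h1]
  have h2 : qBinom q (k + j) j = qBinom q (k + j) k := by
    unfold qBinom
    rw [Nat.add_sub_cancel, Nat.add_sub_cancel_left, mul_comm]
  have h3 : (j : ℤ) * ((j : ℤ) - ((k + j : ℕ) : ℤ)) = (k : ℤ) * ((k : ℤ) - ((k + j : ℕ) : ℤ)) := by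
    push_cast
    ring
  have h4 : (-1 : ℂ) ^ j * (-w⁻¹) ^ (((k + j : ℕ) : ℤ) - 2 * (j : ℤ))
      = (-1) ^ k * w ^ (((k + j : ℕ) : ℤ) - 2 * (k : ℤ)) := by
    have e1 : ((k + j : ℕ) : ℤ) - 2 * (j : ℤ) = (k : ℤ) - j := by
      push_cast
      ring
    have e2 : ((k + j : ℕ) : ℤ) - 2 * (k : ℤ) = -((k : ℤ) - j) := by
      push_cast
      ring
    rw [e1, e2, neg_eq_neg_one_mul w⁻¹, mul_zpow, inv_zpow', ← mul_assoc]
    congr 1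
    rw [← zpow_natCast, ← zpow_add₀ (by norm_num), ← zpow_natCast]
    congr 1
    ring
  rw [h2, h3, mul_assoc, mul_assoc, h4, mul_assoc, mul_assoc]

/-- The defining formula of the Ismail–Masson polynomials. -/
theorem h_sinh (q : ℂ) (n : ℕ) (ξ : ℂ) :
    h q n (Complex.sinh ξ) =
      ∑ k ∈ Finset.range (n + 1),
        qBinom q n k * q ^ ((k : ℤ) * ((k : ℤ) - (n : ℤ))) * (-1) ^ k *
          Complex.exp (((n : ℂ) - 2 * (k : ℂ)) * ξ) := by
  have key : h q n (Complex.sinh ξ) = hermiteSum q n (Complex.exp ξ) := by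
    unfold h
    set r : ℂ := (Complex.sinh ξ ^ 2 + 1) ^ (1 / 2 : ℂ) with hr
    have hr2 : r ^ 2 = Complex.cosh ξ ^ 2 := by
      rw [Complex.cosh_sq, hr, ← Complex.cpow_nat_mul]
      norm_num
    rcases sq_eq_sq_iff_eq_or_eq_neg.1 hr2 with h1 | h1
    · rw [h1, Complex.sinh_add_cosh]
    · rw [h1, ← hermiteSum_neg_inv q n (Complex.exp ξ), ← Complex.exp_neg,
        ← Complex.cosh_sub_sinh]
      congr 1
      ring
  rw [key]
  unfold hermiteSum
  refine Finset.sum_congr rfl fun k _ => ?_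
  rw [← Complex.exp_int_mul]
  push_cast
  rfl

/-- The scaling parameter `s = (1 + τ) / 2 + i θ π / log q`. -/
def scal (q τ θ : ℝ) : ℂ :=
  (1 + (τ : ℂ)) / 2 + Complex.I * ((θ : ℂ) * (Real.pi : ℂ) / (Real.log q : ℂ))

/-- The point `sinh ξ_n = (q ^ (-n s) z - q ^ (n s) z⁻¹) / 2`. -/
def sinhXi (q τ θ : ℝ) (z : ℂ) (n : ℕ) : ℂ :=
  ((q : ℂ) ^ (-(n : ℂ) * scal q τ θ) * z - (q : ℂ) ^ ((n : ℂ) * scal q τ θ) * z⁻¹) / 2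

/-- The principal character modulo 2, `χ(m) = m - 2 ⌊m / 2⌋` (`/` is floor division in `ℤ`). -/
def chi (m : ℤ) : ℤ := m - 2 * (m / 2)

/-- The set `𝕊(θ)` of the fractional parts of the multiples `n θ`, `n ∈ ℕ`. -/
def fracSet (θ : ℝ) : Set ℝ := {x | ∃ n : ℕ, x = Int.fract ((n : ℝ) * θ)}

/-- The generalized irrationality measure `ω(θ₁, …, θ_N | β₁, …, β_N)`: the least upper bound in
the extended reals of the real `r` for which `|n θ_j - β_j - m_j| < 1 / n ^ (r - 1)` for all `j`
holds for infinitely many `(n, m₁, …, m_N)` with `n > 0`. -/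
def irrMeasure {N : ℕ} (θ β : Fin N → ℝ) : EReal :=
  sSup ((fun r : ℝ => (r : EReal)) '' {r : ℝ |
    {p : ℕ × (Fin N → ℤ) | 0 < p.1 ∧
      ∀ j, |(p.1 : ℝ) * θ j - β j - (p.2 j : ℝ)| < 1 / (p.1 : ℝ) ^ (r - 1)}.Infinite})

/-- The truncation index `ν_n = ⌊q ^ 4 (log n) ^ 2 / (1 + log q⁻¹)⌋`. -/
def nuLog (q : ℝ) (n : ℕ) : ℕ := ⌊q ^ 4 * Real.log n ^ 2 / (1 + Real.log q⁻¹)⌋₊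

/-- The truncation index `ν_n = min {⌊(1 + τ) n / 4⌋, ⌊-τ n / 4⌋}`. -/
def nuLin (τ : ℝ) (n : ℕ) : ℕ := min ⌊(1 + τ) * n / 4⌋₊ ⌊-τ * n / 4⌋₊

/-- The factor `z ^ n q ^ (-n ^ 2 s + M (τ n + M)) / ((q; q)_∞ w ^ M)` with `M = ⌊m / 2⌋`. -/
def prefactor (q τ θ : ℝ) (z : ℂ) (n : ℕ) (m : ℤ) (w : ℂ) : ℂ :=
  z ^ n * (q : ℂ) ^ (-(n : ℂ) ^ 2 * scal q τ θ
      + ((m / 2 : ℤ) : ℂ) * ((τ : ℂ) * (n : ℂ) + ((m / 2 : ℤ) : ℂ))) /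
    (qPochInf (q : ℂ) (q : ℂ) * w ^ (m / 2))

/-- The constant `(-q ^ 3; q)_∞ B_q(|z| ^ (-2)) / ((1 - q) (q; q)_∞)`. -/
def constA (q : ℝ) (z : ℂ) : ℝ :=
  qPochInf (-q ^ 3) q * ramanujanB q (‖z‖ ^ 2)⁻¹ / ((1 - q) * qPochInf q q)

/-- The constant `(-q ^ 3; q)_∞ ^ 2 Θ(|z| ^ 2 | √q) / ((1 - q) ^ 2 (q; q)_∞)`. -/
def constTheta (q : ℝ) (z : ℂ) : ℝ :=
  qPochInf (-q ^ 3) q ^ 2 * theta (‖z‖ ^ 2) (Real.sqrt q) / ((1 - q) ^ 2 * qPochInf q q)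

/-- The error bound
`62 (-q ^ 3; q)_∞ ^ 2 Θ(|z| ^ 2 | √q) / ((1 - q) ^ 2 (q; q)_∞)
  * (|z| ^ (2 ν_n) q ^ (ν_n ^ 2) + q ^ (ν_n ^ 2 / 2) / |z| ^ (2 ν_n) + (log n) ^ 2 / n ^ ρ)`. -/
def errTheta (q : ℝ) (z : ℂ) (ρ : ℝ) (n : ℕ) : ℝ :=
  62 * constTheta q z *
    (‖z‖ ^ (2 * nuLog q n) * q ^ (nuLog q n ^ 2)
      + q ^ ((nuLog q n : ℝ) ^ 2 / 2) / ‖z‖ ^ (2 * nuLog q n)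
      + Real.log n ^ 2 / (n : ℝ) ^ ρ)

end IsmailMasson

end

/-! After division by z^n q^(-n² s), the polynomial is Σ_k [n;k]_q q^(k² + τnk) w^(-k) with w = -z²
e^(-2πinθ) (`h_sinhXi`). Everything depends on where the exponent k² + τnk is smallest.

If τ > 0, the term k = 0 dominates and every other term carries a factor q^(nτ). If τ = 0, the
exponent is k², the q-binomial tends to 1/(q;q)_k, and the sum approaches A_q; the argument depends
on n only through nθ modulo 1. If -1 < τ < 0, the minimum lies near k = -τn/2, far from both 0 and
n. Substituting k = ⌊m/2⌋ - j turns the exponent into a constant plus j² + j(χ(m) + β + a), while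
(q;q)_∞ [n;k]_q tends to 1, so the limit is a theta series over ℤ.

Both limits are made quantitative by dominated comparison at a cutoff N (`norm_sub_ramanujanA_le`,
`norm_sub_theta_le`). Inside the cutoff the errors come from the phase, the perturbed power of q and
the defect of the q-binomial; outside it both series are dominated by translates of B_q or Θ(·|√q).
The cutoff is linear in n when nθ and nτ are exact modulo 1, and of size log² n when they are only
approximated to order n^(-ρ).

That suitable n are infinitely many follows from the definition of ω for irrational parameters, from
periodicity modulo the denominator for rational ones, and from the pigeonhole principle when the two
kinds are mixed. -/

noncomputable section

namespace IsmailMasson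

/-! ### q-shifted factorials and q-binomial coefficients -/

section QPochhammer

variable {q : ℝ}

lemma pow_succ_lt_one (hq0 : 0 < q) (hq1 : q < 1) (k : ℕ) : q * q ^ k < 1 := by
  rw [← pow_succ']
  exact pow_lt_one₀ hq0.le hq1 (by omega)

lemma qPoch_succ (a q : ℝ) (n : ℕ) : qPoch a q (n + 1) = qPoch a q n * (1 - a * q ^ n) := by
  simp [qPoch, Finset.prod_range_succ]

lemma qPoch_pos (hq0 : 0 < q) (hq1 : q < 1) (n : ℕ) : 0 < qPoch q q n :=
  Finset.prod_pos fun k _ => sub_pos.2 (pow_succ_lt_one hq0 hq1 k)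

lemma qPoch_antitone (hq0 : 0 < q) (hq1 : q < 1) : Antitone (qPoch q q) := by
  refine antitone_nat_of_succ_le fun n => ?_
  rw [qPoch_succ]
  refine mul_le_of_le_one_right (qPoch_pos hq0 hq1 n).le ?_
  have : 0 < q * q ^ n := by positivity
  linarith

lemma qPoch_le_one (hq0 : 0 < q) (hq1 : q < 1) (n : ℕ) : qPoch q q n ≤ 1 := by
  simpa [qPoch] using qPoch_antitone hq0 hq1 (Nat.zero_le n)

/-- Weierstrass' inequality for the quotients of `q`-shifted factorials. -/
lemma mul_one_sub_le_qPoch (hq0 : 0 < q) (hq1 : q < 1) {n k : ℕ} (hnk : n ≤ k) :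
    qPoch q q n * (1 - q ^ (n + 1) / (1 - q)) ≤ qPoch q q k := by
  have hq : 0 < 1 - q := by linarith
  -- The quotient is the finite geometric sum q^(n+1) + ... + q^(n+i). Keeping it exact lets the
  -- induction close; it is enlarged to the full series only at the end.
  have key : ∀ i, qPoch q q n * (1 - (q ^ (n + 1) - q ^ (n + i + 1)) / (1 - q))
      ≤ qPoch q q (n + i) := by
    intro i
    induction i with
    | zero => simp
    | succ i ih =>
      rw [← add_assoc, qPoch_succ]
      set x := q ^ (n + i) with hx
      have hx0 : 0 < x := by positivity
      have e : (q ^ (n + 1) - q ^ (n + i + 1 + 1)) / (1 - q)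
          = (q ^ (n + 1) - q ^ (n + i + 1)) / (1 - q) + q * x := by
        field_simp
        rw [hx]
        ring
      rw [e]
      have h1 := qPoch_antitone hq0 hq1 (Nat.le_add_right n i)
      have h2 : 0 < q * x := by positivity
      nlinarith
  obtain ⟨i, rfl⟩ := Nat.exists_eq_add_of_le hnk
  refine le_trans ?_ (key i)
  have : 0 < q ^ (n + i + 1) := by positivity
  have h0 := qPoch_pos hq0 hq1 n
  gcongr
  linarith

lemma multipliable_qPochInf {a q : ℝ} (hq0 : 0 < q) (hq1 : q < 1) :
    Multipliable fun k : ℕ => 1 - a * q ^ k := by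
  have : Summable fun k : ℕ => ‖-(a * q ^ k)‖ := by
    simp only [norm_neg, norm_mul, norm_pow]
    refine Summable.mul_left _ (summable_geometric_of_lt_one (norm_nonneg _) ?_)
    rwa [Real.norm_of_nonneg hq0.le]
  simpa [sub_eq_add_neg] using multipliable_one_add_of_summable this

lemma tendsto_qPoch (a : ℝ) (hq0 : 0 < q) (hq1 : q < 1) :
    Filter.Tendsto (qPoch a q) Filter.atTop (nhds (qPochInf a q)) :=
  (multipliable_qPochInf hq0 hq1).hasProd.tendsto_prod_nat

lemma qPochInf_le_qPoch (hq0 : 0 < q) (hq1 : q < 1) (n : ℕ) : qPochInf q q ≤ qPoch q q n :=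
  (qPoch_antitone hq0 hq1).le_of_tendsto (tendsto_qPoch q hq0 hq1) n

lemma mul_one_sub_le_qPochInf (hq0 : 0 < q) (hq1 : q < 1) (n : ℕ) :
    qPoch q q n * (1 - q ^ (n + 1) / (1 - q)) ≤ qPochInf q q :=
  ge_of_tendsto (tendsto_qPoch q hq0 hq1) <|
    (Filter.eventually_ge_atTop n).mono fun _ hk => mul_one_sub_le_qPoch hq0 hq1 hk

/-- Once q^n < 1 - q, the Weierstrass factor is positive and bounds the infinite product away from
0. -/
lemma qPochInf_pos (hq0 : 0 < q) (hq1 : q < 1) : 0 < qPochInf q q := by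
  obtain ⟨n, hn⟩ := exists_pow_lt_of_lt_one (show 0 < 1 - q by linarith) hq1
  refine lt_of_lt_of_le (mul_pos (qPoch_pos hq0 hq1 n) ?_) (mul_one_sub_le_qPochInf hq0 hq1 n)
  rw [sub_pos, div_lt_one (by linarith), pow_succ]
  nlinarith [pow_pos hq0 n]

lemma qPochInf_le_one (hq0 : 0 < q) (hq1 : q < 1) : qPochInf q q ≤ 1 :=
  (qPochInf_le_qPoch hq0 hq1 0).trans (qPoch_le_one hq0 hq1 0)

lemma one_le_qPochInf_neg (hq0 : 0 < q) (hq1 : q < 1) {a : ℝ} (ha : 0 ≤ a) :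
    1 ≤ qPochInf (-a) q := by
  refine ge_of_tendsto' (tendsto_qPoch (-a) hq0 hq1) fun n => ?_
  induction n with
  | zero => simp [qPoch]
  | succ n ih =>
    rw [qPoch_succ]
    have : 0 ≤ a * q ^ n := by positivity
    nlinarith

lemma qPoch_ofReal (q : ℝ) (n : ℕ) : qPoch (q : ℂ) (q : ℂ) n = (qPoch q q n : ℝ) := by
  simp [qPoch]

lemma qPochInf_ofReal (hq0 : 0 < q) (hq1 : q < 1) :
    qPochInf (q : ℂ) (q : ℂ) = (qPochInf q q : ℝ) := by
  have := (multipliable_qPochInf (a := q) hq0 hq1).map_tprod Complex.ofRealHom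
    Complex.continuous_ofReal
  simp only [Complex.ofRealHom_eq_coe] at this
  rw [qPochInf, qPochInf, this]
  simp

lemma qBinom_ofReal (q : ℝ) (n k : ℕ) : qBinom (q : ℂ) n k = (qBinom q n k : ℝ) := by
  simp [qBinom, qPoch_ofReal]

/-- `[n; k]_q (q; q)_k` differs from `1` by at most `q ^ (n - k + 1) / (1 - q)`. -/
lemma qPoch_mul_qBinom (hq0 : 0 < q) (hq1 : q < 1) (n k : ℕ) :
    0 ≤ qPoch q q k * qBinom q n k ∧ qPoch q q k * qBinom q n k ≤ 1 ∧
      1 - q ^ (n - k + 1) / (1 - q) ≤ qPoch q q k * qBinom q n k := by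
  have h1 := qPoch_pos hq0 hq1 k
  have h2 := qPoch_pos hq0 hq1 (n - k)
  have h3 := qPoch_pos hq0 hq1 n
  have e : qPoch q q k * qBinom q n k = qPoch q q n / qPoch q q (n - k) := by
    rw [qBinom]
    field_simp
  rw [e]
  refine ⟨by positivity, ?_, ?_⟩
  · rw [div_le_one h2]
    exact qPoch_antitone hq0 hq1 (Nat.sub_le n k)
  · rw [le_div_iff₀ h2, mul_comm]
    exact mul_one_sub_le_qPoch hq0 hq1 (Nat.sub_le n k)

/-- `(q; q)_∞ [n; k]_q`, extended by zero to all integers `k`. -/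
def binomRatio (q : ℝ) (n : ℕ) (k : ℤ) : ℝ :=
  if 0 ≤ k ∧ k ≤ n then qPochInf q q * qBinom q n k.toNat else 0

lemma binomRatio_natCast {n k : ℕ} (hk : k ≤ n) :
    binomRatio q n k = qPochInf q q * qBinom q n k := by
  simp [binomRatio, hk]

/-- The product factors as ((q;q)_∞ / (q;q)_k) · ((q;q)_n / (q;q)_(n-k)). Both factors lie in [0,
1], so their defects from 1 simply add. -/
lemma qPochInf_mul_qBinom (hq0 : 0 < q) (hq1 : q < 1) (n k : ℕ) :
    0 ≤ qPochInf q q * qBinom q n k ∧ qPochInf q q * qBinom q n k ≤ 1 ∧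
      1 - qPochInf q q * qBinom q n k ≤ q ^ (k + 1) / (1 - q) + q ^ (n - k + 1) / (1 - q) := by
  obtain ⟨h1, h2, h3⟩ := qPoch_mul_qBinom hq0 hq1 n k
  have p1 := qPoch_pos hq0 hq1 k
  have p2 := qPochInf_pos hq0 hq1
  have p3 := qPochInf_le_qPoch hq0 hq1 k
  have p4 := mul_one_sub_le_qPochInf hq0 hq1 k
  have hb : 0 ≤ qBinom q n k := nonneg_of_mul_nonneg_right h1 p1
  refine ⟨by positivity, le_trans (by gcongr) h2, ?_⟩
  have hx : 0 ≤ q ^ (k + 1) / (1 - q) := div_nonneg (by positivity) (by linarith)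
  have := mul_le_mul_of_nonneg_right p4 hb
  nlinarith

lemma binomRatio_nonneg (hq0 : 0 < q) (hq1 : q < 1) (n : ℕ) (k : ℤ) : 0 ≤ binomRatio q n k := by
  unfold binomRatio
  split_ifs with h
  · exact (qPochInf_mul_qBinom hq0 hq1 n _).1
  · rfl

lemma binomRatio_le_one (hq0 : 0 < q) (hq1 : q < 1) (n : ℕ) (k : ℤ) : binomRatio q n k ≤ 1 := by
  unfold binomRatio
  split_ifs with h
  · exact (qPochInf_mul_qBinom hq0 hq1 n _).2.1
  · exact zero_le_one

lemma one_sub_binomRatio_le (hq0 : 0 < q) (hq1 : q < 1) {n p : ℕ} {k : ℤ} (h0 : (p : ℤ) ≤ k)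
    (h1 : k + p ≤ n) : 1 - binomRatio q n k ≤ 2 * q ^ (p + 1) / (1 - q) := by
  lift k to ℕ using by omega
  rw [binomRatio_natCast (by omega)]
  refine (qPochInf_mul_qBinom hq0 hq1 n _).2.2.trans ?_
  have hq : 0 < 1 - q := by linarith
  rw [mul_div_assoc, two_mul]
  have hp : ∀ i, p ≤ i → q ^ (i + 1) ≤ q ^ (p + 1) := fun i hi =>
    pow_le_pow_of_le_one hq0.le hq1.le (by omega)
  gcongr ?_ / _ + ?_ / _
  · exact hp _ (by omega)
  · exact hp _ (by omega)

end QPochhammer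

/-! ### Convergence of the comparison series -/

section Summability

lemma summable_pow_sq_mul_pow {r c : ℝ} (hr0 : 0 < r) (hr1 : r < 1) (hc : 0 < c) :
    Summable fun n : ℕ => r ^ (n ^ 2) * c ^ n := by
  refine summable_of_ratio_test_tendsto_lt_one (l := 0) zero_lt_one
    (Filter.Eventually.of_forall fun n => by positivity) ?_
  have e : (fun n : ℕ => ‖r ^ ((n + 1) ^ 2) * c ^ (n + 1)‖ / ‖r ^ (n ^ 2) * c ^ n‖)
      = fun n : ℕ => (r ^ 2) ^ n * (r * c) := by
    funext n
    rw [Real.norm_of_nonneg (by positivity), Real.norm_of_nonneg (by positivity)]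
    rw [div_eq_iff (by positivity)]
    ring
  rw [e]
  simpa using (tendsto_pow_atTop_nhds_zero_of_lt_one (sq_nonneg r)
    (pow_lt_one₀ hr0.le hr1 two_ne_zero)).mul_const (r * c)

lemma summable_theta {r c : ℝ} (hr0 : 0 < r) (hr1 : r < 1) (hc : 0 < c) :
    Summable fun n : ℤ => r ^ (n ^ 2) * c ^ n := by
  refine Summable.of_nat_of_neg ?_ ?_
  · refine (summable_pow_sq_mul_pow hr0 hr1 hc).congr fun n => ?_
    rw [zpow_natCast, ← zpow_natCast r]
    push_cast
    rfl
  · refine (summable_pow_sq_mul_pow hr0 hr1 (inv_pos.2 hc)).congr fun n => ?_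
    rw [zpow_neg, zpow_natCast, ← zpow_natCast r, inv_pow]
    push_cast
    rw [neg_sq]

lemma summable_ramanujanB {q w : ℝ} (hq0 : 0 < q) (hq1 : q < 1) (hw : 0 < w) :
    Summable fun k : ℕ => q ^ (k ^ 2) * w ^ k / qPoch q q k := by
  refine Summable.of_nonneg_of_le (fun k => ?_) (fun k => ?_)
    ((summable_pow_sq_mul_pow hq0 hq1 hw).div_const (qPochInf q q))
  · have := qPoch_pos hq0 hq1 k
    positivity
  · have := qPochInf_pos hq0 hq1
    have := qPochInf_le_qPoch hq0 hq1 k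
    gcongr

end Summability

/-! ### Expansion in powers of z -/

section Expansion

variable {q : ℝ}

lemma ofReal_cpow_eq_exp (hq0 : 0 < q) (x : ℂ) : (q : ℂ) ^ x = Complex.exp (Real.log q * x) := by
  rw [Complex.cpow_def_of_ne_zero (by exact_mod_cast hq0.ne'), Complex.ofReal_log hq0.le]

lemma ofReal_rpow_eq_exp (hq0 : 0 < q) (x : ℝ) :
    ((q ^ x : ℝ) : ℂ) = Complex.exp (Real.log q * x) := by
  rw [Complex.ofReal_cpow hq0.le, ofReal_cpow_eq_exp hq0]

/-- The expansion of `h_n(sinh ξ_n | q)` in powers of `z`. -/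
lemma h_sinhXi (hq0 : 0 < q) (hq1 : q < 1) {z : ℂ} (hz : z ≠ 0) (τ θ : ℝ) (n : ℕ) :
    h q n (sinhXi q τ θ z n) = z ^ n * (q : ℂ) ^ (-(n : ℂ) ^ 2 * scal q τ θ) *
      ∑ k ∈ Finset.range (n + 1), ((qBinom q n k : ℝ) : ℂ) *
        ((q ^ ((k : ℝ) ^ 2 + τ * n * k) : ℝ) : ℂ) *
          (-z ^ 2 * Complex.exp (-2 * n * θ * Real.pi * Complex.I))⁻¹ ^ k := by
  have hL : (Real.log q : ℂ) ≠ 0 := by exact_mod_cast (Real.log_neg hq0 hq1).ne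
  set L : ℂ := (Real.log q : ℂ) with hLdef
  set ξ : ℂ := -(n : ℂ) * scal q τ θ * L + Complex.log z with hξ
  have hx : sinhXi q τ θ z n = Complex.sinh ξ := by
    rw [sinhXi, Complex.sinh, hξ, neg_add, Complex.exp_add, Complex.exp_add, Complex.exp_neg
      (Complex.log z), Complex.exp_log hz, ofReal_cpow_eq_exp hq0, ofReal_cpow_eq_exp hq0, ← hLdef]
    have e1 : L * (-(n : ℂ) * scal q τ θ) = -(n : ℂ) * scal q τ θ * L := by ring
    have e2 : L * ((n : ℂ) * scal q τ θ) = -(-(n : ℂ) * scal q τ θ * L) := by ring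
    rw [e1, e2]
  rw [hx, h_sinh, Finset.mul_sum]
  refine Finset.sum_congr rfl fun k _ => ?_
  have e1 : (q : ℂ) ^ ((k : ℤ) * ((k : ℤ) - (n : ℤ))) = Complex.exp (L * (k * (k - n))) := by
    rw [← Complex.cpow_intCast, ofReal_cpow_eq_exp hq0]
    push_cast
    rfl
  have e2 : Complex.exp ((n - 2 * k) * ξ)
      = z ^ n * (z ^ 2)⁻¹ ^ k * Complex.exp ((n - 2 * k) * (-(n : ℂ) * scal q τ θ * L)) := by
    rw [hξ, mul_add, Complex.exp_add, mul_comm]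
    congr 1
    rw [sub_mul, Complex.exp_sub, Complex.exp_nat_mul, Complex.exp_log hz, mul_comm (2 : ℂ),
      mul_assoc, Complex.exp_nat_mul]
    rw [two_mul, Complex.exp_add, Complex.exp_log hz, inv_pow, div_eq_mul_inv, sq]
  have e3 : (-z ^ 2 * Complex.exp (-2 * n * θ * Real.pi * Complex.I))⁻¹ ^ k
      = (-1) ^ k * (z ^ 2)⁻¹ ^ k * Complex.exp (k * (2 * n * θ * Real.pi * Complex.I)) := by
    rw [Complex.exp_nat_mul, ← mul_pow, ← mul_pow, mul_inv, ← Complex.exp_neg, inv_neg,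
      neg_one_mul]
    congr 4
    ring
  rw [e1, e2, e3, qBinom_ofReal, ofReal_rpow_eq_exp hq0, ofReal_cpow_eq_exp hq0, ← hLdef]
  -- Since 2s = 1 + τ + 2iθπ / log q, the exponent k(k - n) - (n - 2k)ns equals -n²s + k² + τnk +
  -- 2iknθπ / log q. The last summand is the source of the phase.
  have e4 : Complex.exp (L * (k * (k - n))) *
        Complex.exp ((n - 2 * k) * (-(n : ℂ) * scal q τ θ * L))
      = Complex.exp (L * (-(n : ℂ) ^ 2 * scal q τ θ)) *
        Complex.exp (L * ((((k : ℝ) ^ 2 + τ * n * k : ℝ)) : ℂ)) *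
        Complex.exp (k * (2 * n * θ * Real.pi * Complex.I)) := by
    rw [← Complex.exp_add, ← Complex.exp_add, ← Complex.exp_add]
    congr 1
    rw [scal, ← hLdef]
    push_cast
    field_simp
    ring
  linear_combination ((qBinom q n k : ℝ) : ℂ) * (-1) ^ k * z ^ n * (z ^ 2)⁻¹ ^ k * e4

lemma norm_thetaArg (z : ℂ) (x : ℝ) :
    ‖-z ^ 2 * Complex.exp (x * Complex.I)‖ = ‖z‖ ^ 2 := by
  rw [norm_mul, Complex.norm_exp_ofReal_mul_I, norm_neg, norm_pow, mul_one]

end Expansion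

/-! ### Comparison with A_q -/

section RamanujanEstimate

variable {q : ℝ}

/-- Comparison of a truncated and damped series with a full one, dominated by `B_q`. -/
lemma norm_sub_ramanujanA_le (hq0 : 0 < q) (hq1 : q < 1) {z : ℂ} (hz : z ≠ 0) {n N : ℕ}
    (hN : N ≤ n) {u v : ℂ} (hu : ‖u‖ = (‖z‖ ^ 2)⁻¹) (hv : ‖v‖ = (‖z‖ ^ 2)⁻¹) {δ E : ℝ}
    (hδ0 : 0 ≤ δ) (hE0 : 0 ≤ E)
    (hδ : ∀ k : ℕ, k ≤ N → ‖u ^ k - v ^ k‖ ≤ δ * (‖z‖ ^ 2)⁻¹ ^ k)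
    (hE : ∀ l : ℕ, 1 ≤ l → q ^ ((N + l) ^ 2) * (‖z‖ ^ 2)⁻¹ ^ N ≤ E * q ^ (l ^ 2)) :
    ‖∑ k ∈ Finset.range (n + 1), ((qBinom q n k : ℝ) : ℂ) * ((q ^ (k ^ 2) : ℝ) : ℂ) * u ^ k
      - ramanujanA (q : ℂ) (-v)‖ ≤
      (δ + q ^ (n - N + 1) / (1 - q) + 2 * E / qPochInf q q) * ramanujanB q (‖z‖ ^ 2)⁻¹ := by
  have hzn : 0 < ‖z‖ := norm_pos_iff.2 hz
  set y := (‖z‖ ^ 2)⁻¹ with hy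
  have hy0 : 0 < y := by positivity
  have hq : 0 < 1 - q := by linarith
  have hP := qPochInf_pos hq0 hq1
  set β : ℕ → ℝ := fun k => q ^ (k ^ 2) * y ^ k / qPoch q q k with hβ
  have hβs : Summable β := summable_ramanujanB hq0 hq1 hy0
  have hβ0 : ∀ k, 0 ≤ β k := fun k => by
    have := qPoch_pos hq0 hq1 k
    positivity
  set F : ℕ → ℂ := fun k => if k < n + 1 then
    ((qBinom q n k : ℝ) : ℂ) * ((q ^ (k ^ 2) : ℝ) : ℂ) * u ^ k else 0 with hF
  have hFs : HasSum F (∑ k ∈ Finset.range (n + 1),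
      ((qBinom q n k : ℝ) : ℂ) * ((q ^ (k ^ 2) : ℝ) : ℂ) * u ^ k) := by
    have e : ∑ k ∈ Finset.range (n + 1), ((qBinom q n k : ℝ) : ℂ) * ((q ^ (k ^ 2) : ℝ) : ℂ) * u ^ k
        = ∑ k ∈ Finset.range (n + 1), F k :=
      Finset.sum_congr rfl fun k hk => by simp only [hF, if_pos (Finset.mem_range.1 hk)]
    rw [e]
    exact hasSum_sum_of_ne_finset_zero fun k hk => if_neg (by simpa using hk)
  set G : ℕ → ℂ := fun k => (q : ℂ) ^ (k ^ 2) / qPoch (q : ℂ) q k * (- -v) ^ k with hG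
  have hGn : ∀ k, ‖G k‖ = β k := by
    intro k
    simp only [hG, hβ, neg_neg, norm_mul, norm_div, norm_pow, qPoch_ofReal, hv,
      Complex.norm_real, Real.norm_of_nonneg hq0.le, Real.norm_of_nonneg (qPoch_pos hq0 hq1 k).le]
    ring
  have hGs : HasSum G (ramanujanA (q : ℂ) (-v)) :=
    (Summable.of_norm (by simpa only [hGn] using hβs)).hasSum
  have hFn : ∀ k, ‖F k‖ ≤ β k := by
    intro k
    simp only [hF]
    split_ifs
    · obtain ⟨h1, h2, -⟩ := qPoch_mul_qBinom hq0 hq1 n k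
      have hp := qPoch_pos hq0 hq1 k
      have hb : 0 ≤ qBinom q n k := nonneg_of_mul_nonneg_right h1 hp
      rw [norm_mul, norm_mul, norm_pow, hu, Complex.norm_real, Complex.norm_real,
        Real.norm_of_nonneg hb, Real.norm_of_nonneg (by positivity), hβ]
      rw [le_div_iff₀ hp]
      have : 0 ≤ q ^ (k ^ 2) * y ^ k := by positivity
      nlinarith
    · simpa using hβ0 k
  -- The tail is dominated by a translate of the series of B_q, whose sum is again B_q. This makes
  -- the whole error a multiple of B_q.
  set T : ℕ → ℝ := fun k => if N ≤ k then β (k - N) else 0 with hT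
  have hTs : HasSum T (ramanujanB q y) := by
    have h1 : HasSum (fun k => T (k + N)) (ramanujanB q y) := by
      simp only [hT, Nat.le_add_left, if_true, Nat.add_sub_cancel]
      exact hβs.hasSum
    rw [hasSum_nat_add_iff] at h1
    have h2 : ∑ i ∈ Finset.range N, T i = 0 :=
      Finset.sum_eq_zero fun i hi => if_neg (by simpa using hi)
    rwa [h2, add_zero] at h1
  have hT0 : ∀ k, 0 ≤ T k := fun k => by
    simp only [hT]
    split_ifs
    · exact hβ0 _
    · rfl
  have hD := hFs.sub hGs
  have hdom := (hβs.hasSum.mul_left (δ + q ^ (n - N + 1) / (1 - q))).add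
    (hTs.mul_left (2 * E / qPochInf q q))
  rw [add_mul]
  rw [← hD.tsum_eq]
  refine tsum_of_norm_bounded hdom fun k => ?_
  rcases le_or_gt k N with hk | hk
  · refine le_add_of_le_of_nonneg ?_ (mul_nonneg (by positivity) (hT0 k))
    obtain ⟨h1, h2, h3⟩ := qPoch_mul_qBinom hq0 hq1 n k
    have hp := qPoch_pos hq0 hq1 k
    -- Below the cutoff the difference splits into a phase error, weighted by c ≤ 1, and the defect
    -- 1 - c.
    set c := qPoch q q k * qBinom q n k with hc
    have e : F k - G k
        = ((q ^ (k ^ 2) / qPoch q q k : ℝ) : ℂ) * ((c : ℂ) * (u ^ k - v ^ k) - (1 - c) * v ^ k) := by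
      have hp' : ((qPoch q q k : ℝ) : ℂ) ≠ 0 := by exact_mod_cast hp.ne'
      simp only [hF, hG, if_pos (show k < n + 1 by omega), qPoch_ofReal, hc, neg_neg]
      push_cast
      field_simp
      ring
    have hpow : q ^ (n - k + 1) / (1 - q) ≤ q ^ (n - N + 1) / (1 - q) := by
      gcongr ?_ / _
      exact pow_le_pow_of_le_one hq0.le hq1.le (by omega)
    have hb : ‖(c : ℂ) * (u ^ k - v ^ k) - (1 - c) * v ^ k‖
        ≤ (δ + q ^ (n - N + 1) / (1 - q)) * y ^ k := by
      refine (norm_sub_le _ _).trans ?_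
      rw [norm_mul, norm_mul, norm_pow, hv, Complex.norm_real, Real.norm_of_nonneg h1,
        ← Complex.ofReal_one, ← Complex.ofReal_sub, Complex.norm_real,
        Real.norm_of_nonneg (by linarith), add_mul]
      refine add_le_add ((mul_le_of_le_one_left (norm_nonneg _) h2).trans (hδ k hk)) ?_
      gcongr
      linarith
    rw [e, norm_mul, Complex.norm_real, Real.norm_of_nonneg (by positivity)]
    calc _ ≤ q ^ (k ^ 2) / qPoch q q k * ((δ + q ^ (n - N + 1) / (1 - q)) * y ^ k) := by gcongr
      _ = _ := by
        simp only [hβ]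
        ring
  · refine le_add_of_nonneg_of_le (mul_nonneg (by positivity) (hβ0 k)) ?_
    have h2 : ‖F k - G k‖ ≤ 2 * β k := by
      refine (norm_sub_le _ _).trans ?_
      rw [hGn]
      linarith [hFn k]
    refine h2.trans ?_
    obtain ⟨l, rfl⟩ := Nat.exists_eq_add_of_le hk.le
    simp only [hT, if_pos hk.le, Nat.add_sub_cancel_left, hβ]
    -- Bounding (q;q)_(N+l) below by (q;q)_∞ and then using (q;q)_l ≤ 1 restores the denominator of
    -- the l-th term of B_q.
    have hl := hE l (by omega)
    have p1 := qPochInf_le_qPoch hq0 hq1 (N + l)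
    have p2 := qPoch_le_one hq0 hq1 l
    have p3 := qPoch_pos hq0 hq1 l
    calc 2 * (q ^ ((N + l) ^ 2) * y ^ (N + l) / qPoch q q (N + l))
        ≤ 2 * (q ^ ((N + l) ^ 2) * y ^ (N + l) / qPochInf q q) := by gcongr
      _ = 2 * ((q ^ ((N + l) ^ 2) * y ^ N) * y ^ l / qPochInf q q) := by rw [pow_add y]; ring
      _ ≤ 2 * ((E * q ^ (l ^ 2)) * y ^ l / qPochInf q q) := by gcongr
      _ = 2 * E / qPochInf q q * (q ^ (l ^ 2) * y ^ l / 1) := by ring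
      _ ≤ _ := by gcongr

end RamanujanEstimate

/-! ### Comparison with the theta function -/

section ThetaEstimate

variable {q : ℝ}

/-- The exact form of `h_n(sinh ξ_n | q)` in which the sum runs over all integers `j = M - k`
with `M = ⌊m / 2⌋`. -/
lemma exists_hasSum_h_sinhXi (hq0 : 0 < q) (hq1 : q < 1) {z : ℂ} (hz : z ≠ 0) (τ θ : ℝ) (n : ℕ)
    (m : ℤ) {w : ℂ} (hw : w = -z ^ 2 * Complex.exp (-2 * n * θ * Real.pi * Complex.I)) :
    ∃ S : ℂ, HasSum (fun j : ℤ => ((binomRatio q n (m / 2 - j) : ℝ) : ℂ) *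
        ((q ^ ((j : ℝ) ^ 2 + j * (-τ * n - 2 * (m / 2 : ℤ))) : ℝ) : ℂ) * w ^ j) S ∧
      h q n (sinhXi q τ θ z n) = prefactor q τ θ z n m w * S := by
  have hw0 : w ≠ 0 := by
    rw [hw]
    exact mul_ne_zero (neg_ne_zero.2 (pow_ne_zero 2 hz)) (Complex.exp_ne_zero _)
  have hP : ((qPochInf q q : ℝ) : ℂ) ≠ 0 := by exact_mod_cast (qPochInf_pos hq0 hq1).ne'
  set M : ℤ := m / 2 with hM
  set g : ℤ → ℂ := fun k => ((binomRatio q n k : ℝ) : ℂ) *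
    ((q ^ ((k : ℝ) ^ 2 + τ * n * k) : ℝ) : ℂ) * w ^ (-k) with hg
  set s : ℂ := ∑ k ∈ Finset.range (n + 1), ((qBinom q n k : ℝ) : ℂ) *
    ((q ^ ((k : ℝ) ^ 2 + τ * n * k) : ℝ) : ℂ) * w⁻¹ ^ k with hs
  have h1 : HasSum g (((qPochInf q q : ℝ) : ℂ) * s) := by
    have e : ((qPochInf q q : ℝ) : ℂ) * s =
        ∑ k ∈ (Finset.range (n + 1)).map (Nat.castEmbedding (R := ℤ)), g k := by
      rw [hs, Finset.sum_map, Finset.mul_sum]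
      refine Finset.sum_congr rfl fun k hk => ?_
      have hk' : k ≤ n := by
        have := Finset.mem_range.1 hk
        omega
      simp only [hg, Nat.castEmbedding_apply, binomRatio_natCast hk', zpow_neg, zpow_natCast,
        inv_pow, Int.cast_natCast]
      push_cast
      ring
    rw [e]
    refine hasSum_sum_of_ne_finset_zero fun k hk => ?_
    have : ¬(0 ≤ k ∧ k ≤ n) := fun ⟨h0, hn⟩ => hk <| by
      lift k to ℕ using h0
      simpa using (by omega : k < n + 1)
    simp [hg, binomRatio, this]
  set x : ℝ := q ^ ((M : ℝ) * (τ * n + M)) with hx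
  have hx0 : (x : ℂ) ≠ 0 := by
    have : 0 < x := by positivity
    exact_mod_cast this.ne'
  -- Recentring by k = M - j and dividing by the powers of q and w at k = M leaves j² + j(-τn - 2M),
  -- whose linear coefficient stays bounded because 2M is close to -τn.
  have h2 : HasSum (fun j => (x : ℂ)⁻¹ * w ^ M * g (M - j))
      ((x : ℂ)⁻¹ * w ^ M * (((qPochInf q q : ℝ) : ℂ) * s)) :=
    ((Equiv.subLeft M).hasSum_iff.2 h1).mul_left _
  refine ⟨(x : ℂ)⁻¹ * w ^ M * (((qPochInf q q : ℝ) : ℂ) * s), ?_, ?_⟩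
  · convert h2 using 2 with j
    have e1 : ((M - j : ℤ) : ℝ) ^ 2 + τ * n * (M - j : ℤ)
        = M * (τ * n + M) + ((j : ℝ) ^ 2 + j * (-τ * n - 2 * M)) := by
      push_cast
      ring
    have hwM : w ^ M ≠ 0 := zpow_ne_zero M hw0
    simp only [hg]
    rw [e1, Real.rpow_add hq0 (M * (τ * n + M)), ← hx, neg_sub, zpow_sub₀ hw0]
    push_cast
    field_simp
  · rw [h_sinhXi hq0 hq1 hz, ← hw, ← hs, prefactor, qPochInf_ofReal hq0 hq1, ← hM]
    have e : (q : ℂ) ^ (-(n : ℂ) ^ 2 * scal q τ θ + (M : ℂ) * (τ * n + M))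
        = (q : ℂ) ^ (-(n : ℂ) ^ 2 * scal q τ θ) * x := by
      rw [Complex.cpow_add _ _ (by exact_mod_cast hq0.ne'), hx, Complex.ofReal_cpow hq0.le]
      push_cast
      rfl
    have hwM : w ^ M ≠ 0 := zpow_ne_zero M hw0
    rw [e]
    field_simp

/-- The general term of `Θ(c | √q)`. -/
lemma hasSum_theta_sqrt (hq0 : 0 < q) (hq1 : q < 1) {c : ℝ} (hc : 0 < c) :
    HasSum (fun j : ℤ => q ^ ((j : ℝ) ^ 2 / 2) * c ^ j) (theta c (Real.sqrt q)) := by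
  have h : HasSum _ (theta c (Real.sqrt q)) := (summable_theta (Real.sqrt_pos.2 hq0)
    ((Real.sqrt_lt' one_pos).2 (by simpa using hq1)) hc).hasSum
  convert h using 3 with j
  rw [Real.sqrt_eq_rpow, ← Real.rpow_intCast, ← Real.rpow_mul hq0.le]
  push_cast
  congr 1
  ring

lemma theta_sqrt_nonneg (hq0 : 0 < q) (hq1 : q < 1) {c : ℝ} (hc : 0 < c) :
    0 ≤ theta c (Real.sqrt q) :=
  (hasSum_theta_sqrt hq0 hq1 hc).nonneg fun j => by positivity

/-- Comparison of a truncated and perturbed theta series with `Θ(v q ^ t₀ | q)`. -/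
lemma norm_sub_theta_le (hq0 : 0 < q) (hq1 : q < 1) {y : ℝ} (hy : 0 < y) {v w : ℂ}
    (hw : ‖w‖ = y) (hv : ‖v‖ = y) {N : ℕ} (hN : 5 ≤ N) {c : ℤ → ℝ} (hc0 : ∀ j, 0 ≤ c j)
    (hc1 : ∀ j, c j ≤ 1) {t t₀ : ℝ} (ht : -1 ≤ t) (ht' : t ≤ 3) (h0 : 0 ≤ t₀) (h0' : t₀ ≤ 2)
    {δ : ℝ} (hδ0 : 0 ≤ δ)
    (hδ : ∀ j : ℤ, 0 ≤ j → j ≤ N →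
      ‖(c j : ℂ) * ((q ^ (j * (t - t₀)) : ℝ) : ℂ) * w ^ j - v ^ j‖ ≤ δ * y ^ j)
    (hδ' : ∀ j : ℤ, j < 0 → -N ≤ j →
      ‖(c j : ℂ) * ((q ^ (j * (t - t₀)) : ℝ) : ℂ) * w ^ j - v ^ j‖ ≤ q ^ 2 * δ * y ^ j)
    {S : ℂ} (hS : HasSum (fun j : ℤ =>
      (c j : ℂ) * ((q ^ ((j : ℝ) ^ 2 + j * t) : ℝ) : ℂ) * w ^ j) S) :
    ‖S - theta (v * ((q ^ t₀ : ℝ) : ℂ)) (q : ℂ)‖ ≤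
      (δ + 2 * (y ^ N * q ^ (N ^ 2)) + 2 * (q ^ ((N : ℝ) ^ 2 / 2) / y ^ N)) *
        theta y (Real.sqrt q) := by
  have hΘ := hasSum_theta_sqrt hq0 hq1 hy
  set ϑ : ℤ → ℝ := fun j => q ^ ((j : ℝ) ^ 2 / 2) * y ^ j with hϑ
  have hϑ0 : ∀ j, 0 ≤ ϑ j := fun j => by positivity
  have hmono : ∀ {a b : ℝ}, b ≤ a → q ^ a ≤ q ^ b := fun hab =>
    Real.rpow_le_rpow_of_exponent_ge hq0 hq1.le hab
  have hexp : ∀ j : ℤ, 0 ≤ j → q ^ ((j : ℝ) ^ 2 + j * t₀) ≤ q ^ ((j : ℝ) ^ 2 / 2) := by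
    intro j hj
    have hj' : (0 : ℝ) ≤ j := by exact_mod_cast hj
    exact hmono (by nlinarith [mul_nonneg hj' h0])
  -- For negative j the linear term works against convergence. As t₀ ≤ 2, two extra powers of q
  -- suffice: 2 + j² + 2j - j²/2 = (j + 2)²/2 ≥ 0. This is why `hδ'` asks for the factor q².
  have hexp' : ∀ j : ℤ, j < 0 →
      q ^ 2 * q ^ ((j : ℝ) ^ 2 + j * t₀) ≤ q ^ ((j : ℝ) ^ 2 / 2) := by
    intro j hj
    have hj' : (j : ℝ) < 0 := by exact_mod_cast hj
    rw [← Real.rpow_natCast, ← Real.rpow_add hq0]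
    refine hmono ?_
    push_cast
    nlinarith [sq_nonneg ((j : ℝ) + 2)]
  set G : ℤ → ℂ := fun j => ((q ^ ((j : ℝ) ^ 2 + j * t₀) : ℝ) : ℂ) * v ^ j with hG
  have hGn : ∀ j, ‖G j‖ = q ^ ((j : ℝ) ^ 2 + j * t₀) * y ^ j := fun j => by
    rw [hG, norm_mul, norm_zpow, hv, Complex.norm_real, Real.norm_of_nonneg (by positivity)]
  have hGs : HasSum G (theta (v * ((q ^ t₀ : ℝ) : ℂ)) (q : ℂ)) := by
    have h1 : Summable G := by
      refine Summable.of_norm_bounded (hΘ.summable.mul_left (q ^ 2)⁻¹) fun j => ?_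
      rw [hGn, ← mul_assoc]
      gcongr
      rw [← div_eq_inv_mul, le_div_iff₀' (by positivity)]
      rcases le_or_gt 0 j with hj | hj
      · refine le_trans ?_ (hexp j hj)
        exact mul_le_of_le_one_left (by positivity) (pow_le_one₀ hq0.le hq1.le)
      · exact hexp' j hj
    have h2 : theta (v * ((q ^ t₀ : ℝ) : ℂ)) (q : ℂ) = ∑' j, G j := by
      refine tsum_congr fun j => ?_
      simp only [hG]
      rw [mul_zpow, Real.rpow_add hq0, mul_comm (j : ℝ), Real.rpow_mul hq0.le,
        Real.rpow_intCast]
      have : q ^ ((j : ℝ) ^ 2) = q ^ (j ^ 2) := by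
        rw [← Real.rpow_intCast]
        push_cast
        rfl
      rw [this]
      push_cast
      ring
    rw [h2]
    exact h1.hasSum
  -- The dominating series are Θ(y|√q) for the middle range and its translates by N and -N for the
  -- two tails; all three have the same sum.
  have hdom := ((hΘ.mul_left (δ)).add
    (((Equiv.subRight (N : ℤ)).hasSum_iff.2 hΘ).mul_left (2 * (y ^ N * q ^ (N ^ 2))))).add
    (((Equiv.addRight (N : ℤ)).hasSum_iff.2 hΘ).mul_left (2 * (q ^ ((N : ℝ) ^ 2 / 2) / y ^ N)))
  rw [add_mul, add_mul, ← (hS.sub hGs).tsum_eq]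
  refine tsum_of_norm_bounded hdom fun j => ?_
  simp only [Function.comp_apply, Equiv.subRight_apply, Equiv.coe_addRight]
  have hN' : (5 : ℝ) ≤ N := by exact_mod_cast hN
  have n1 : 0 ≤ δ * ϑ j := mul_nonneg (by positivity) (hϑ0 _)
  have n2 : 0 ≤ 2 * (y ^ N * q ^ (N ^ 2)) * ϑ (j - N) := mul_nonneg (by positivity) (hϑ0 _)
  have n3 : 0 ≤ 2 * (q ^ ((N : ℝ) ^ 2 / 2) / y ^ N) * ϑ (j + N) :=
    mul_nonneg (by positivity) (hϑ0 _)
  rcases le_or_gt |j| N with hj | hj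
  · suffices ‖(c j : ℂ) * ((q ^ ((j : ℝ) ^ 2 + j * t) : ℝ) : ℂ) * w ^ j - G j‖
        ≤ δ * ϑ j by linarith
    have e : (c j : ℂ) * ((q ^ ((j : ℝ) ^ 2 + j * t) : ℝ) : ℂ) * w ^ j - G j
        = ((q ^ ((j : ℝ) ^ 2 + j * t₀) : ℝ) : ℂ) *
          ((c j : ℂ) * ((q ^ (j * (t - t₀)) : ℝ) : ℂ) * w ^ j - v ^ j) := by
      have : (j : ℝ) ^ 2 + j * t = ((j : ℝ) ^ 2 + j * t₀) + j * (t - t₀) := by ring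
      rw [this, Real.rpow_add hq0 _ (j * (t - t₀)), hG]
      push_cast
      ring
    rw [e, norm_mul, Complex.norm_real, Real.norm_of_nonneg (by positivity)]
    obtain ⟨hj1, hj2⟩ := abs_le.1 hj
    rcases le_or_gt 0 j with hj0 | hj0
    · calc _ ≤ q ^ ((j : ℝ) ^ 2 / 2) * (δ * y ^ j) := by
            exact mul_le_mul (hexp j hj0) (hδ j hj0 hj2) (norm_nonneg _) (by positivity)
        _ = _ := by
          simp only [hϑ]
          ring
    · calc _ ≤ q ^ ((j : ℝ) ^ 2 + j * t₀) * (q ^ 2 * δ * y ^ j) := by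
            gcongr
            exact hδ' j hj0 hj1
        _ = (q ^ 2 * q ^ ((j : ℝ) ^ 2 + j * t₀)) * (δ * y ^ j) := by ring
        _ ≤ q ^ ((j : ℝ) ^ 2 / 2) * (δ * y ^ j) := by
            gcongr
            exact hexp' j hj0
        _ = _ := by
          simp only [hϑ]
          ring
  · have hF : ‖(c j : ℂ) * ((q ^ ((j : ℝ) ^ 2 + j * t) : ℝ) : ℂ) * w ^ j‖
        ≤ q ^ ((j : ℝ) ^ 2 + j * t) * y ^ j := by
      rw [norm_mul, norm_mul, norm_zpow, hw, Complex.norm_real, Complex.norm_real,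
        Real.norm_of_nonneg (hc0 j), Real.norm_of_nonneg (by positivity)]
      gcongr
      exact mul_le_of_le_one_left (by positivity) (hc1 j)
    have htri : ‖(c j : ℂ) * ((q ^ ((j : ℝ) ^ 2 + j * t) : ℝ) : ℂ) * w ^ j - G j‖
        ≤ q ^ ((j : ℝ) ^ 2 + j * t) * y ^ j + q ^ ((j : ℝ) ^ 2 + j * t₀) * y ^ j := by
      refine (norm_sub_le _ _).trans ?_
      rw [hGn]
      gcongr
    rcases lt_abs.1 hj with hj | hj
    · have hl : (N : ℝ) + 1 ≤ j := by exact_mod_cast hj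
      -- With j = N + l and x = -1 the excess over N² + l²/2 is N(l - 1) + l(N - 1) + l²/2 ≥ 0, so
      -- the full q^(N²) survives.
      have key : ∀ x : ℝ, -1 ≤ x → q ^ ((j : ℝ) ^ 2 + j * x) * y ^ j
          ≤ (y ^ N * q ^ (N ^ 2)) * ϑ (j - N) := by
        intro x hx
        have e : (y ^ N * q ^ (N ^ 2)) * ϑ (j - N)
            = q ^ ((N : ℝ) ^ 2 + ((j : ℝ) - N) ^ 2 / 2) * y ^ j := by
          simp only [hϑ]
          rw [zpow_sub₀ hy.ne', zpow_natCast, Real.rpow_add hq0, ← Real.rpow_natCast q (N ^ 2)]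
          push_cast
          field_simp
        rw [e]
        gcongr ?_ * _
        refine hmono ?_
        have h1 : (j : ℝ) * (-1) ≤ j * x := by
          gcongr
          linarith
        obtain ⟨l, hl'⟩ : ∃ l : ℝ, (j : ℝ) = N + l := ⟨j - N, by ring⟩
        have hl1 : 1 ≤ l := by linarith
        rw [hl'] at h1 ⊢
        nlinarith [mul_nonneg (show 0 ≤ (N : ℝ) by linarith) (show 0 ≤ l - 1 by linarith),
          mul_nonneg (show 0 ≤ l by linarith) (show 0 ≤ (N : ℝ) - 1 by linarith), sq_nonneg l]
      have k1 := key t ht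
      have k2 := key t₀ (by linarith)
      linarith
    · have hl : (j : ℝ) ≤ -N - 1 := by
        have : j ≤ -N - 1 := by omega
        exact_mod_cast this
      -- With j = -N - l the worst case x = 3 costs 3(N + l). Half of N² is given up to absorb it,
      -- which succeeds for N ≥ 5 and explains q^(N²/2).
      have key : ∀ x : ℝ, x ≤ 3 → q ^ ((j : ℝ) ^ 2 + j * x) * y ^ j
          ≤ (q ^ ((N : ℝ) ^ 2 / 2) / y ^ N) * ϑ (j + N) := by
        intro x hx
        have e : (q ^ ((N : ℝ) ^ 2 / 2) / y ^ N) * ϑ (j + N)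
            = q ^ ((N : ℝ) ^ 2 / 2 + ((j : ℝ) + N) ^ 2 / 2) * y ^ j := by
          simp only [hϑ]
          rw [zpow_add₀ hy.ne', zpow_natCast, Real.rpow_add hq0]
          push_cast
          field_simp
        rw [e]
        gcongr ?_ * _
        refine hmono ?_
        have h1 : (j : ℝ) * 3 ≤ j * x := mul_le_mul_of_nonpos_left hx (by linarith)
        obtain ⟨l, hl'⟩ : ∃ l : ℝ, (j : ℝ) = -N - l := ⟨-j - N, by ring⟩
        have hl1 : 1 ≤ l := by linarith
        rw [hl'] at h1 ⊢
        nlinarith [mul_nonneg (show 0 ≤ (N : ℝ) - 5 by linarith) (show 0 ≤ l - 1 by linarith),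
          sq_nonneg (l - 1), mul_nonneg (show 0 ≤ (N : ℝ) - 5 by linarith)
            (show 0 ≤ (N : ℝ) by linarith)]
      have k1 := key t ht'
      have k2 := key t₀ (by linarith)
      linarith

end ThetaEstimate

/-! ### Perturbation of phase, power and binomial -/

section Perturbation

variable {q : ℝ}

/-- The factor x is replaced by 1 first, while its coefficient c·e has norm at most 1; hence no
upper bound on x is needed. -/
lemma norm_mul_mul_sub_one_le {c x : ℝ} {e : ℂ} (hc0 : 0 ≤ c) (hc1 : c ≤ 1) (he : ‖e‖ = 1) :
    ‖(c : ℂ) * x * e - 1‖ ≤ |x - 1| + ‖e - 1‖ + (1 - c) := by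
  have h : (c : ℂ) * x * e - 1 = c * e * ((x - 1 : ℝ) : ℂ) + c * (e - 1) + ((c - 1 : ℝ) : ℂ) := by
    push_cast
    ring
  rw [h]
  refine (norm_add₃_le).trans ?_
  rw [norm_mul, norm_mul, norm_mul, he, Complex.norm_real, Complex.norm_real, Complex.norm_real,
    Real.norm_of_nonneg hc0, Real.norm_eq_abs, Real.norm_eq_abs, abs_sub_comm c,
    abs_of_nonneg (sub_nonneg.2 hc1), mul_one]
  gcongr
  · exact mul_le_of_le_one_left (abs_nonneg _) hc1
  · exact mul_le_of_le_one_left (norm_nonneg _) hc1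

lemma norm_exp_two_pi_sub_one_le (x : ℝ) :
    ‖Complex.exp (2 * Real.pi * Complex.I * x) - 1‖ ≤ 2 * Real.pi * |x| := by
  have h : (2 * Real.pi * Complex.I * x : ℂ) = Complex.I * ((2 * Real.pi * x : ℝ) : ℂ) := by
    push_cast
    ring
  rw [h]
  refine Real.norm_exp_I_mul_ofReal_sub_one_le.trans ?_
  rw [Real.norm_eq_abs, abs_mul, abs_of_nonneg Real.two_pi_pos.le]

lemma abs_rpow_sub_one_le (hq0 : 0 < q) (hq1 : q < 1) {x ε : ℝ} (hx : |x| ≤ ε)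
    (hε : ε * Real.log q⁻¹ ≤ 1) : |q ^ x - 1| ≤ 2 * (ε * Real.log q⁻¹) := by
  have hl : 0 < Real.log q⁻¹ := Real.log_pos ((one_lt_inv₀ hq0).2 hq1)
  have h : |Real.log q * x| ≤ ε * Real.log q⁻¹ := by
    rw [abs_mul, ← abs_neg, ← Real.log_inv, abs_of_pos hl, mul_comm]
    gcongr
  rw [Real.rpow_def_of_pos hq0]
  exact (Real.abs_exp_sub_one_le (h.trans hε)).trans (by linarith)

/-- The theta function approximation of `h_n(sinh ξ_n | q)` with an explicit error bound. -/
lemma exists_h_sinhXi_eq_theta (hq0 : 0 < q) (hq1 : q < 1) {z : ℂ} (hz : z ≠ 0) (τ θ : ℝ) {n : ℕ}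
    {m m₁ : ℤ} {β₁ β₂ a b ε : ℝ} (hβ0 : 0 ≤ β₁) (hβ1 : β₁ < 1) (hm : -τ * n = m + β₁ + a)
    (hm₁ : (n : ℝ) * θ = m₁ + β₂ + b) (ha1 : |a| ≤ 1) (ha : |a| ≤ ε) (hb : |b| ≤ ε) {N p : ℕ}
    (hN : 5 ≤ N) (hε : N * ε * Real.log q⁻¹ ≤ 1) (h1 : (N + p : ℤ) ≤ m / 2)
    (h2 : m / 2 + N + p + 2 ≤ n) :
    ∃ r : ℂ, h q n (sinhXi q τ θ z n)
        = prefactor q τ θ z n m (-z ^ 2 * Complex.exp (-2 * n * θ * Real.pi * Complex.I)) *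
          (theta (-z ^ 2 * (q : ℂ) ^ ((chi m : ℂ) + β₁) *
            Complex.exp (-2 * β₂ * Real.pi * Complex.I)) (q : ℂ) + r) ∧
      ‖r‖ ≤ ((q ^ 2)⁻¹ * (2 * Real.pi * (N * ε) * (1 + Real.log q⁻¹)) + 2 * q ^ (p + 1) / (1 - q)
        + 2 * (‖z‖ ^ (2 * N) * q ^ (N ^ 2)) + 2 * (q ^ ((N : ℝ) ^ 2 / 2) / ‖z‖ ^ (2 * N))) *
          theta (‖z‖ ^ 2) (Real.sqrt q) := by
  have hzn : 0 < ‖z‖ := norm_pos_iff.2 hz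
  have hl : 0 < Real.log q⁻¹ := Real.log_pos ((one_lt_inv₀ hq0).2 hq1)
  have hq : 0 < 1 - q := by linarith
  have hε0 : 0 ≤ ε := (abs_nonneg a).trans ha
  have hpi := Real.pi_gt_three
  set w : ℂ := -z ^ 2 * Complex.exp (-2 * n * θ * Real.pi * Complex.I) with hw
  set v : ℂ := -z ^ 2 * Complex.exp (-2 * β₂ * Real.pi * Complex.I) with hv
  have hwn : ‖w‖ = ‖z‖ ^ 2 := by
    rw [← norm_thetaArg z (-2 * n * θ * Real.pi), hw]
    push_cast
    rfl
  have hvn : ‖v‖ = ‖z‖ ^ 2 := by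
    rw [← norm_thetaArg z (-2 * β₂ * Real.pi), hv]
    push_cast
    rfl
  -- The integer m₁ disappears from the phase, so only the approximation error b separates w from v.
  have hwv : w = v * Complex.exp (2 * Real.pi * Complex.I * ((-b : ℝ) : ℂ)) := by
    have e : Complex.exp (-2 * n * θ * Real.pi * Complex.I)
        = Complex.exp (-2 * β₂ * Real.pi * Complex.I) *
          Complex.exp (2 * Real.pi * Complex.I * ((-b : ℝ) : ℂ)) := by
      have h' : (n : ℂ) * θ = m₁ + β₂ + b := by exact_mod_cast hm₁
      rw [← Complex.exp_add, Complex.exp_eq_exp_iff_exists_int]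
      refine ⟨-m₁, ?_⟩
      push_cast
      linear_combination (-2 * Real.pi * Complex.I) * h'
    rw [hw, hv, e]
    ring
  obtain ⟨S, hS, hh⟩ := exists_hasSum_h_sinhXi hq0 hq1 hz τ θ n m hw
  have hchi : (m : ℝ) = 2 * ((m / 2 : ℤ) : ℝ) + chi m := by
    have : m = 2 * (m / 2) + chi m := by
      rw [chi]
      ring
    exact_mod_cast this
  have hchi0 : (0 : ℝ) ≤ chi m ∧ (chi m : ℝ) ≤ 1 := by
    have : 0 ≤ chi m ∧ chi m ≤ 1 := by
      rw [chi]
      omega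
    exact ⟨by exact_mod_cast this.1, by exact_mod_cast this.2⟩
  obtain ⟨ha2, ha3⟩ := abs_le.1 ha1
  have ht : -τ * n - 2 * (m / 2 : ℤ) = chi m + β₁ + a := by
    rw [hm, hchi]
    ring
  rw [ht] at hS
  have harg : -z ^ 2 * (q : ℂ) ^ ((chi m : ℂ) + β₁) *
      Complex.exp (-2 * β₂ * Real.pi * Complex.I) = v * ((q ^ ((chi m : ℝ) + β₁) : ℝ) : ℂ) := by
    rw [hv, Complex.ofReal_cpow hq0.le]
    push_cast
    ring
  set κ : ℝ := 2 * Real.pi * (N * ε) * (1 + Real.log q⁻¹) with hκ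
  have hκ0 : 0 ≤ κ := by positivity
  have hdiff : ∀ j : ℤ, |j| ≤ N → ∀ d : ℝ, 1 - binomRatio q n (m / 2 - j) ≤ d →
      ‖((binomRatio q n (m / 2 - j) : ℝ) : ℂ) *
        ((q ^ ((j : ℝ) * (chi m + β₁ + a - (chi m + β₁))) : ℝ) : ℂ) * w ^ j - v ^ j‖
        ≤ (κ + d) * (‖z‖ ^ 2) ^ j := by
    intro j hj d hd
    have hj' : |(j : ℝ)| ≤ N := by exact_mod_cast hj
    set e : ℂ := Complex.exp (2 * Real.pi * Complex.I * ((j * -b : ℝ) : ℂ)) with he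
    have hwj : w ^ j = v ^ j * e := by
      rw [hwv, mul_zpow, ← Complex.exp_int_mul, he]
      congr 2
      push_cast
      ring
    have he1 : ‖e‖ = 1 := by
      rw [he, ← Complex.norm_exp_ofReal_mul_I (2 * Real.pi * (j * -b))]
      congr 2
      push_cast
      ring
    have hx : chi m + β₁ + a - (chi m + β₁) = a := by ring
    rw [hx, hwj]
    set x : ℝ := q ^ ((j : ℝ) * a) with hxdef
    have hfac : ((binomRatio q n (m / 2 - j) : ℝ) : ℂ) * (x : ℂ) * (v ^ j * e) - v ^ j
        = v ^ j * (((binomRatio q n (m / 2 - j) : ℝ) : ℂ) * x * e - 1) := by ring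
    rw [hfac, norm_mul, norm_zpow, hvn, mul_comm]
    gcongr
    refine (norm_mul_mul_sub_one_le (binomRatio_nonneg hq0 hq1 _ _)
      (binomRatio_le_one hq0 hq1 _ _) he1).trans ?_
    have hja : |(j : ℝ) * a| ≤ N * ε := by
      rw [abs_mul]
      gcongr
    have hjb : |(j : ℝ) * -b| ≤ N * ε := by
      rw [abs_mul, abs_neg]
      gcongr
    have b1 := abs_rpow_sub_one_le hq0 hq1 hja hε
    have b2 := norm_exp_two_pi_sub_one_le (j * -b)
    have b3 : 2 * Real.pi * |(j : ℝ) * -b| ≤ 2 * Real.pi * (N * ε) := by gcongr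
    have b4 : 2 * (N * ε * Real.log q⁻¹) ≤ 2 * Real.pi * (N * ε) * Real.log q⁻¹ := by
      have : 0 ≤ N * ε * Real.log q⁻¹ := by positivity
      nlinarith
    rw [hκ]
    linarith
  have hq2 : 1 ≤ (q ^ 2)⁻¹ := (one_le_inv₀ (by positivity)).2 (pow_le_one₀ hq0.le hq1.le)
  -- The q^(-2) in front of κ pays for the factor q² demanded at negative j.
  have hest := norm_sub_theta_le hq0 hq1 (show 0 < ‖z‖ ^ 2 by positivity) hwn hvn hN
    (fun j => binomRatio_nonneg hq0 hq1 n (m / 2 - j))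
    (fun j => binomRatio_le_one hq0 hq1 n (m / 2 - j))
    (t := chi m + β₁ + a) (t₀ := chi m + β₁) (by linarith) (by linarith) (by linarith)
    (by linarith) (δ := (q ^ 2)⁻¹ * κ + 2 * q ^ (p + 1) / (1 - q)) (by positivity) ?_ ?_ hS
  · refine ⟨S - theta (v * ((q ^ ((chi m : ℝ) + β₁) : ℝ) : ℂ)) (q : ℂ), ?_, ?_⟩
    · rw [harg, hh, add_sub_cancel]
    · simpa only [pow_mul] using hest
  · intro j hj0 hjN
    refine (hdiff j (abs_le.2 ⟨by omega, hjN⟩) _ (one_sub_binomRatio_le hq0 hq1 (p := p) (by omega)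
      (by omega))).trans ?_
    gcongr
    exact le_mul_of_one_le_left hκ0 hq2
  -- For j < 0 the index ⌊m/2⌋ - j is at distance at least p + 2 from 0, and from n by the extra 2
  -- in `h2`. So the binomial defect gains q², and the bound is exactly q²δ.
  · intro j hj0 hjN
    refine (hdiff j (abs_le.2 ⟨hjN, by omega⟩) _ (one_sub_binomRatio_le hq0 hq1 (p := p + 2)
      (by push_cast; omega) (by push_cast; omega))).trans (le_of_eq ?_)
    congr 1
    field_simp
    ring

end Perturbation

/-! ### Growth of the logarithmic cutoff -/

section Asymptotics

open Filter Topology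

variable {q : ℝ}

/-- The shape of ν_n is chosen for this product: 1 + log q⁻¹ cancels the same factor in the
perturbation error, and q⁴ outweighs the q^(-2) lost at negative j. -/
lemma nuLog_le (hq0 : 0 < q) (hq1 : q < 1) (n : ℕ) :
    (nuLog q n : ℝ) * (1 + Real.log q⁻¹) ≤ q ^ 4 * Real.log n ^ 2 := by
  have hl : 0 < Real.log q⁻¹ := Real.log_pos ((one_lt_inv₀ hq0).2 hq1)
  rw [← le_div_iff₀ (by positivity)]
  exact Nat.floor_le (by positivity)

lemma nuLog_le_log_sq (hq0 : 0 < q) (hq1 : q < 1) (n : ℕ) : (nuLog q n : ℝ) ≤ Real.log n ^ 2 := by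
  have hl : 0 < Real.log q⁻¹ := Real.log_pos ((one_lt_inv₀ hq0).2 hq1)
  have h1 := nuLog_le hq0 hq1 n
  have h2 : q ^ 4 * Real.log n ^ 2 ≤ Real.log n ^ 2 :=
    mul_le_of_le_one_left (sq_nonneg _) (pow_le_one₀ hq0.le hq1.le)
  nlinarith [Nat.cast_nonneg (α := ℝ) (nuLog q n)]

lemma tendsto_nuLog (hq0 : 0 < q) (hq1 : q < 1) : Tendsto (nuLog q) atTop atTop := by
  have hl : 0 < Real.log q⁻¹ := Real.log_pos ((one_lt_inv₀ hq0).2 hq1)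
  refine tendsto_nat_floor_atTop.comp ?_
  refine Tendsto.atTop_div_const (by positivity) (Tendsto.const_mul_atTop (by positivity) ?_)
  exact (tendsto_pow_atTop two_ne_zero).comp
    (Real.tendsto_log_atTop.comp tendsto_natCast_atTop_atTop)

lemma eventually_log_sq_le {c s : ℝ} (hc : 0 < c) (hs : 0 < s) :
    ∀ᶠ n : ℕ in atTop, Real.log n ^ 2 ≤ c * (n : ℝ) ^ s := by
  have h := (isLittleO_log_rpow_rpow_atTop 2 hs).def hc
  filter_upwards [tendsto_natCast_atTop_atTop.eventually h] with n hn
  rw [Real.norm_eq_abs, Real.norm_of_nonneg (by positivity)] at hn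
  exact_mod_cast (le_abs_self _).trans hn

lemma eventually_nuLog_le (hq0 : 0 < q) (hq1 : q < 1) {c : ℝ} (hc : 0 < c) :
    ∀ᶠ n : ℕ in atTop, (nuLog q n : ℝ) ≤ c * n := by
  filter_upwards [eventually_log_sq_le hc one_pos] with n hn
  rw [Real.rpow_one] at hn
  exact (nuLog_le_log_sq hq0 hq1 n).trans hn

lemma eventually_rpow_le_log_sq_div (hq0 : 0 < q) (hq1 : q < 1) {c : ℝ} (hc : 0 < c) (ρ : ℝ) :
    ∀ᶠ n : ℕ in atTop, q ^ (c * n) ≤ Real.log n ^ 2 / (n : ℝ) ^ ρ := by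
  have hl : 0 < Real.log q⁻¹ := Real.log_pos ((one_lt_inv₀ hq0).2 hq1)
  have h1 := (tendsto_rpow_mul_exp_neg_mul_atTop_nhds_zero ρ (Real.log q⁻¹ * c)
    (by positivity)).comp tendsto_natCast_atTop_atTop
  have h2 := Real.tendsto_log_atTop.comp (tendsto_natCast_atTop_atTop (R := ℝ))
  filter_upwards [h1.eventually_le_const one_pos, h2.eventually_ge_atTop 1, eventually_gt_atTop 0]
    with n h1 h2 h3
  have hn : (0 : ℝ) < n := by exact_mod_cast h3
  simp only [Function.comp_apply] at h1 h2
  rw [le_div_iff₀ (by positivity), Real.rpow_def_of_pos hq0]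
  have e : Real.log q * (c * n) = -(Real.log q⁻¹ * c) * n := by
    rw [Real.log_inv]
    ring
  rw [e]
  nlinarith

lemma eventually_nuLog_mul_le (hq0 : 0 < q) (hq1 : q < 1) {ρ : ℝ} (hρ : 0 < ρ) :
    ∀ᶠ n : ℕ in atTop, nuLog q n * (1 / (n : ℝ) ^ ρ) * Real.log q⁻¹ ≤ 1 := by
  filter_upwards [eventually_log_sq_le one_pos hρ, eventually_gt_atTop 0] with n hn h0
  have hn0 : (0 : ℝ) < n := by exact_mod_cast h0
  have h1 := nuLog_le hq0 hq1 n
  have h2 : q ^ 4 * Real.log n ^ 2 ≤ Real.log n ^ 2 :=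
    mul_le_of_le_one_left (sq_nonneg _) (pow_le_one₀ hq0.le hq1.le)
  have h3 := Nat.cast_nonneg (α := ℝ) (nuLog q n)
  rw [mul_one_div, div_mul_eq_mul_div, div_le_one (by positivity)]
  linarith

lemma eventually_one_div_rpow_le_one {ρ : ℝ} (hρ : 0 < ρ) :
    ∀ᶠ n : ℕ in atTop, 1 / (n : ℝ) ^ ρ ≤ 1 := by
  filter_upwards [eventually_ge_atTop 1] with n hn
  have hn' : (1 : ℝ) ≤ n := by exact_mod_cast hn
  exact div_le_one_of_le₀ (Real.one_le_rpow hn' hρ.le) (by positivity)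

end Asymptotics

/-! ### Existence of infinitely many admissible n -/

section Infinite

lemma exists_lt_of_lt_irrMeasure_sub_one {N : ℕ} {θ β : Fin N → ℝ} {ρ : ℝ}
    (h : (ρ : EReal) < irrMeasure θ β - 1) :
    ∃ r : ℝ, ρ < r - 1 ∧ {p : ℕ × (Fin N → ℤ) | 0 < p.1 ∧
      ∀ j, |(p.1 : ℝ) * θ j - β j - (p.2 j : ℝ)| < 1 / (p.1 : ℝ) ^ (r - 1)}.Infinite := by
  have h1 := EReal.add_lt_of_lt_sub h
  obtain ⟨_, ⟨r, hr, rfl⟩, hlt⟩ := lt_sSup_iff.1 h1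
  refine ⟨r, ?_, hr⟩
  have : ρ + 1 < r := by
    simp only at hlt
    exact_mod_cast hlt
  linarith

/-- The measure counts tuples (n, m). For ρ > 0 each n admits only finitely many m, as every m_j
lies within 1 of nθ_j - β_j; so infinitely many tuples force infinitely many n. -/
lemma infinite_of_lt_irrMeasure_sub_one {N : ℕ} {θ β : Fin N → ℝ} {ρ : ℝ} (hρ : 0 < ρ)
    (h : (ρ : EReal) < irrMeasure θ β - 1) :
    {n : ℕ | 0 < n ∧ ∀ j, ∃ m : ℤ, |(n : ℝ) * θ j - β j - m| < 1 / (n : ℝ) ^ ρ}.Infinite := by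
  obtain ⟨r, hr, hinf⟩ := exists_lt_of_lt_irrMeasure_sub_one h
  intro hfin
  refine hinf (Set.Finite.subset (hfin.biUnion (t := fun n => ({n} : Set ℕ) ×ˢ Set.univ.pi
    fun j => Set.Icc (⌊(n : ℝ) * θ j - β j⌋ - 1) (⌈(n : ℝ) * θ j - β j⌉ + 1)) fun n _ =>
      (Set.finite_singleton n).prod (Set.Finite.pi fun j => Set.finite_Icc _ _)) ?_)
  rintro ⟨n, m⟩ ⟨hn, hm⟩
  simp only at hn hm
  have hn1 : (1 : ℝ) ≤ n := by exact_mod_cast hn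
  have hle : 1 / (n : ℝ) ^ (r - 1) ≤ 1 / (n : ℝ) ^ ρ :=
    one_div_le_one_div_of_le (by positivity) (Real.rpow_le_rpow_of_exponent_le hn1 hr.le)
  have hone : 1 / (n : ℝ) ^ ρ ≤ 1 :=
    div_le_one_of_le₀ (Real.one_le_rpow hn1 hρ.le) (by positivity)
  simp only [Set.mem_iUnion, Set.mem_prod, Set.mem_singleton_iff, Set.mem_pi, Set.mem_univ,
    forall_true_left, Set.mem_Icc]
  refine ⟨n, ⟨hn, fun j => ⟨m j, (hm j).trans_le hle⟩⟩, rfl, fun j => ?_⟩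
  have := abs_lt.1 ((hm j).trans_le (hle.trans hone))
  have f1 := Int.floor_le ((n : ℝ) * θ j - β j)
  have f2 := Int.le_ceil ((n : ℝ) * θ j - β j)
  constructor
  · rw [← Int.cast_le (R := ℝ)]
    push_cast
    linarith
  · rw [← Int.cast_le (R := ℝ)]
    push_cast
    linarith

lemma fract_natCast_mul_add {θ : ℝ} {d : ℕ} {p : ℤ} (h : d * θ = p) (n t : ℕ) :
    Int.fract (((n + d * t : ℕ) : ℝ) * θ) = Int.fract ((n : ℝ) * θ) := by
  have : ((n + d * t : ℕ) : ℝ) * θ = (n : ℝ) * θ + ((p * t : ℤ) : ℝ) := by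
    push_cast
    rw [← h]
    ring
  rw [this, Int.fract_add_intCast]

lemma exists_mul_eq_intCast {θ : ℝ} (h : θ ∈ Set.range ((↑) : ℚ → ℝ)) :
    ∃ (d : ℕ) (p : ℤ), 0 < d ∧ d * θ = p := by
  obtain ⟨x, rfl⟩ := h
  refine ⟨x.den, x.num, x.den_pos, ?_⟩
  exact_mod_cast (mul_comm _ _).trans x.mul_den_eq_num

lemma finite_fracSet {θ : ℝ} (h : θ ∈ Set.range ((↑) : ℚ → ℝ)) : (fracSet θ).Finite := by
  obtain ⟨d, p, hd, hp⟩ := exists_mul_eq_intCast h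
  refine (Set.finite_Iio d |>.image fun n : ℕ => Int.fract ((n : ℝ) * θ)).subset ?_
  rintro _ ⟨n, rfl⟩
  refine ⟨n % d, Nat.mod_lt n hd, ?_⟩
  have := fract_natCast_mul_add hp (n % d) (n / d)
  rw [Nat.mod_add_div] at this
  exact this.symm

lemma infinite_fract_eq {θ l : ℝ} (h : θ ∈ Set.range ((↑) : ℚ → ℝ)) (hl : l ∈ fracSet θ) :
    {n : ℕ | 0 < n ∧ l = Int.fract ((n : ℝ) * θ)}.Infinite := by
  obtain ⟨d, p, hd, hp⟩ := exists_mul_eq_intCast h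
  obtain ⟨n, rfl⟩ := hl
  -- The shift t + 1 keeps the index positive even when the given n is 0.
  refine Set.infinite_of_injective_forall_mem (f := fun t : ℕ => n + d * (t + 1)) ?_ fun t => ?_
  · intro s t hst
    simpa [hd.ne'] using hst
  · exact ⟨by positivity, (fract_natCast_mul_add hp n (t + 1)).symm⟩

/-- Pigeonhole principle for the fractional parts of the multiples of a rational number. -/
lemma exists_infinite_fract_eq {θ : ℝ} (h : θ ∈ Set.range ((↑) : ℚ → ℝ)) {T : Set ℕ}
    (hT : T.Infinite) : ∃ l ∈ fracSet θ, {n ∈ T | l = Int.fract ((n : ℝ) * θ)}.Infinite := by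
  by_contra! hcon
  refine hT (((finite_fracSet h).biUnion fun l hl =>
    hcon l hl).subset fun n hn => ?_)
  simp only [Set.mem_iUnion]
  exact ⟨_, ⟨n, rfl⟩, hn, rfl⟩

lemma mem_range_neg {τ : ℝ} (h : τ ∈ Set.range ((↑) : ℚ → ℝ)) :
    -τ ∈ Set.range ((↑) : ℚ → ℝ) := by
  obtain ⟨x, rfl⟩ := h
  exact ⟨-x, by push_cast; rfl⟩

lemma fracSet_mem_Ico {θ l : ℝ} (hl : l ∈ fracSet θ) : 0 ≤ l ∧ l < 1 := by
  obtain ⟨n, rfl⟩ := hl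
  exact ⟨Int.fract_nonneg _, Int.fract_lt_one _⟩

end Infinite

/-! ### The three regimes of τ -/

section Main

open Filter Topology

variable {q : ℝ}

lemma norm_inv_thetaArg {z : ℂ} (n : ℕ) (θ : ℝ) :
    ‖(-z ^ 2 * Complex.exp (-2 * n * θ * Real.pi * Complex.I))⁻¹‖ = (‖z‖ ^ 2)⁻¹ := by
  rw [norm_inv, ← norm_thetaArg z (-2 * n * θ * Real.pi)]
  push_cast
  rfl

lemma ramanujanB_nonneg (hq0 : 0 < q) (hq1 : q < 1) {w : ℝ} (hw : 0 ≤ w) : 0 ≤ ramanujanB q w :=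
  tsum_nonneg fun k => by
    have := qPoch_pos hq0 hq1 k
    positivity

/-- The case `τ > 0`. -/
theorem h_sinhXi_of_pos (hq0 : 0 < q) (hq1 : q < 1) {z : ℂ} (hz : z ≠ 0) {τ : ℝ} (hτ : 0 < τ)
    (θ : ℝ) (n : ℕ) : ∃ r : ℂ,
      h q n (sinhXi q τ θ z n) / (z ^ n * (q : ℂ) ^ (-(n : ℂ) ^ 2 * scal q τ θ)) = 1 + r ∧
      ‖r‖ ≤ q * ramanujanB q (q ^ 2 * (‖z‖ ^ 2)⁻¹) / ((1 - q) * ‖z‖ ^ 2) * q ^ ((n : ℝ) * τ) := by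
  have hzn : 0 < ‖z‖ := norm_pos_iff.2 hz
  have hq : 0 < 1 - q := by linarith
  have hc : z ^ n * (q : ℂ) ^ (-(n : ℂ) ^ 2 * scal q τ θ) ≠ 0 := by
    rw [ofReal_cpow_eq_exp hq0]
    exact mul_ne_zero (pow_ne_zero _ hz) (Complex.exp_ne_zero _)
  rw [h_sinhXi hq0 hq1 hz, mul_div_cancel_left₀ _ hc, Finset.sum_range_succ', add_comm]
  set y := (‖z‖ ^ 2)⁻¹ with hy
  have hy0 : 0 < y := by positivity
  refine ⟨_, congrArg (· + _) (?_ : _ = (1 : ℂ)), ?_⟩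
  · have h0 : qBinom q n 0 = 1 := by
      simpa [qBinom, qPoch] using div_self (qPoch_pos hq0 hq1 n).ne'
    simp [h0]
  · have hs := summable_ramanujanB (w := q ^ 2 * y) hq0 hq1 (by positivity)
    -- From (k + 1)² = k² + 2k + 1 come the argument q²/|z|² of B_q and the prefactor q/|z|². The
    -- denominator 1 - q comes from (q;q)_(k+1) ≥ (1 - q)(q;q)_k, and q^(τnk) ≤ 1 is discarded.
    have key : ∀ k : ℕ, ‖((qBinom q n (k + 1) : ℝ) : ℂ) *
        ((q ^ (((k + 1 : ℕ) : ℝ) ^ 2 + τ * n * (k + 1 : ℕ)) : ℝ) : ℂ) *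
          (-z ^ 2 * Complex.exp (-2 * n * θ * Real.pi * Complex.I))⁻¹ ^ (k + 1)‖
        ≤ q * y / (1 - q) * q ^ ((n : ℝ) * τ) * (q ^ (k ^ 2) * (q ^ 2 * y) ^ k / qPoch q q k) := by
      intro k
      obtain ⟨h1, h2, -⟩ := qPoch_mul_qBinom hq0 hq1 n (k + 1)
      have hp := qPoch_pos hq0 hq1 (k + 1)
      have hp' := qPoch_pos hq0 hq1 k
      have hb : 0 ≤ qBinom q n (k + 1) := nonneg_of_mul_nonneg_right h1 hp
      rw [norm_mul, norm_mul, norm_pow, norm_inv_thetaArg, Complex.norm_real, Complex.norm_real,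
        Real.norm_of_nonneg hb, Real.norm_of_nonneg (by positivity), ← hy]
      have hb1 : qBinom q n (k + 1) ≤ 1 / ((1 - q) * qPoch q q k) := by
        rw [le_div_iff₀ (by positivity)]
        have h3 : q * q ^ k ≤ q := mul_le_of_le_one_right hq0.le (pow_le_one₀ hq0.le hq1.le)
        have h4 : (1 - q) * qPoch q q k ≤ qPoch q q (k + 1) := by
          rw [qPoch_succ, mul_comm]
          gcongr
        calc _ ≤ qBinom q n (k + 1) * qPoch q q (k + 1) := by gcongr
          _ ≤ 1 := by rwa [mul_comm]
      have hx : q ^ (((k + 1 : ℕ) : ℝ) ^ 2 + τ * n * (k + 1 : ℕ))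
          ≤ q ^ ((k + 1) ^ 2) * q ^ ((n : ℝ) * τ) := by
        rw [← Real.rpow_natCast q ((k + 1) ^ 2), ← Real.rpow_add hq0]
        refine Real.rpow_le_rpow_of_exponent_ge hq0 hq1.le ?_
        push_cast
        have : 0 ≤ τ * n * k := by positivity
        linarith
      calc _ ≤ 1 / ((1 - q) * qPoch q q k) * (q ^ ((k + 1) ^ 2) * q ^ ((n : ℝ) * τ)) *
            y ^ (k + 1) := by gcongr
        _ = _ := by
          field_simp
          ring
    have hfin := Finset.sum_le_sum fun k (_ : k ∈ Finset.range n) => key k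
    refine (norm_sum_le _ _).trans (hfin.trans ?_)
    rw [← Finset.mul_sum]
    have hle := hs.sum_le_tsum (Finset.range n) fun k _ => by
      have := qPoch_pos hq0 hq1 k
      positivity
    calc _ ≤ q * y / (1 - q) * q ^ ((n : ℝ) * τ) * ramanujanB q (q ^ 2 * y) := by
          gcongr
          exact hle
      _ = _ := by
        rw [hy]
        field_simp

/-- The normalised polynomial for `τ = 0`. -/
lemma h_sinhXi_zero_div (hq0 : 0 < q) (hq1 : q < 1) {z : ℂ} (hz : z ≠ 0) (θ : ℝ) (n : ℕ) :
    h q n (sinhXi q 0 θ z n) / (z ^ n * (q : ℂ) ^ (-(n : ℂ) ^ 2 / 2)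
        * Complex.exp (-(n : ℂ) ^ 2 * θ * Real.pi * Complex.I))
      = ∑ k ∈ Finset.range (n + 1), ((qBinom q n k : ℝ) : ℂ) * ((q ^ (k ^ 2) : ℝ) : ℂ) *
          (-z ^ 2 * Complex.exp (-2 * n * θ * Real.pi * Complex.I))⁻¹ ^ k := by
  have hL : (Real.log q : ℂ) ≠ 0 := by exact_mod_cast (Real.log_neg hq0 hq1).ne
  have e : z ^ n * (q : ℂ) ^ (-(n : ℂ) ^ 2 / 2)
      * Complex.exp (-(n : ℂ) ^ 2 * θ * Real.pi * Complex.I)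
      = z ^ n * (q : ℂ) ^ (-(n : ℂ) ^ 2 * scal q 0 θ) := by
    rw [ofReal_cpow_eq_exp hq0, ofReal_cpow_eq_exp hq0, mul_assoc, ← Complex.exp_add, scal]
    congr 2
    push_cast
    field_simp
    ring
  have hc : z ^ n * (q : ℂ) ^ (-(n : ℂ) ^ 2 * scal q 0 θ) ≠ 0 := by
    rw [ofReal_cpow_eq_exp hq0]
    exact mul_ne_zero (pow_ne_zero _ hz) (Complex.exp_ne_zero _)
  rw [e, h_sinhXi hq0 hq1 hz, mul_div_cancel_left₀ _ hc]
  refine Finset.sum_congr rfl fun k _ => ?_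
  have hk : (k : ℝ) ^ 2 + 0 * n * k = ((k ^ 2 : ℕ) : ℝ) := by
    push_cast
    ring
  rw [hk, Real.rpow_natCast]

/-- The approximation by `A_q` for `τ = 0` with an explicit error bound. -/
lemma exists_h_sinhXi_eq_ramanujanA (hq0 : 0 < q) (hq1 : q < 1) {z : ℂ} (hz : z ≠ 0) {θ : ℝ}
    {n N : ℕ} {m : ℤ} {β γ ε : ℝ} (hm : (n : ℝ) * θ = m + β + γ) (hγ : |γ| ≤ ε) (hN : N ≤ n)
    {E : ℝ} (hE0 : 0 ≤ E)
    (hE : ∀ l : ℕ, 1 ≤ l → q ^ ((N + l) ^ 2) * (‖z‖ ^ 2)⁻¹ ^ N ≤ E * q ^ (l ^ 2)) :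
    ∃ r : ℂ, h q n (sinhXi q 0 θ z n) / (z ^ n * (q : ℂ) ^ (-(n : ℂ) ^ 2 / 2)
        * Complex.exp (-(n : ℂ) ^ 2 * θ * Real.pi * Complex.I))
      = ramanujanA (q : ℂ) (Complex.exp (2 * Real.pi * Complex.I * β) / z ^ 2) + r ∧
      ‖r‖ ≤ constA q z * (2 * Real.pi * (N * ε) + q ^ (n - N + 1) + 2 * E) := by
  have hzn : 0 < ‖z‖ := norm_pos_iff.2 hz
  have hq : 0 < 1 - q := by linarith
  have hε0 : 0 ≤ ε := (abs_nonneg γ).trans hγ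
  set u : ℂ := (-z ^ 2 * Complex.exp (-2 * n * θ * Real.pi * Complex.I))⁻¹ with hu
  set v : ℂ := -(Complex.exp (2 * Real.pi * Complex.I * β) / z ^ 2) with hv
  have hun : ‖u‖ = (‖z‖ ^ 2)⁻¹ := norm_inv_thetaArg n θ
  have hvn : ‖v‖ = (‖z‖ ^ 2)⁻¹ := by
    have := Complex.norm_exp_ofReal_mul_I (2 * Real.pi * β)
    have e : (2 * Real.pi * Complex.I * β : ℂ) = ((2 * Real.pi * β : ℝ) : ℂ) * Complex.I := by
      push_cast
      ring
    rw [hv, norm_neg, norm_div, e, this, norm_pow, one_div]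
  have huv : u = v * Complex.exp (2 * Real.pi * Complex.I * (γ : ℂ)) := by
    have e : Complex.exp (-2 * n * θ * Real.pi * Complex.I)
        = (Complex.exp (2 * Real.pi * Complex.I * β) *
            Complex.exp (2 * Real.pi * Complex.I * γ))⁻¹ := by
      have h' : (n : ℂ) * θ = m + β + γ := by exact_mod_cast hm
      rw [← Complex.exp_add, ← Complex.exp_neg, Complex.exp_eq_exp_iff_exists_int]
      refine ⟨-m, ?_⟩
      push_cast
      linear_combination (-2 * Real.pi * Complex.I) * h'
    rw [hu, hv, e, mul_inv, inv_inv, inv_neg]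
    ring
  have hδ : ∀ k : ℕ, k ≤ N → ‖u ^ k - v ^ k‖ ≤ 2 * Real.pi * (N * ε) * (‖z‖ ^ 2)⁻¹ ^ k := by
    intro k hk
    have e : u ^ k - v ^ k
        = v ^ k * (Complex.exp (2 * Real.pi * Complex.I * ((k * γ : ℝ) : ℂ)) - 1) := by
      rw [huv, mul_pow, ← Complex.exp_nat_mul, mul_sub, mul_one]
      congr 3
      push_cast
      ring
    rw [e, norm_mul, norm_pow, hvn, mul_comm]
    gcongr
    refine (norm_exp_two_pi_sub_one_le _).trans ?_
    rw [abs_mul, Nat.abs_cast]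
    gcongr
  have hmain := norm_sub_ramanujanA_le hq0 hq1 hz hN hun hvn (by positivity) hE0 hδ hE
  refine ⟨_, (add_sub_cancel _ _).symm, ?_⟩
  rw [h_sinhXi_zero_div hq0 hq1 hz, ← hu]
  rw [hv, neg_neg] at hmain
  refine hmain.trans ?_
  have hB := ramanujanB_nonneg hq0 hq1 (inv_nonneg.2 (sq_nonneg ‖z‖))
  have hP0 := qPochInf_pos hq0 hq1
  have hP1 := qPochInf_le_one hq0 hq1
  have hP3 := one_le_qPochInf_neg hq0 hq1 (a := q ^ 3) (by positivity)
  have hden : 0 < (1 - q) * qPochInf q q := by positivity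
  -- The factor (-q³;q)_∞ ≥ 1 only enlarges the bound to the stated constant.
  have hC : ramanujanB q (‖z‖ ^ 2)⁻¹ / ((1 - q) * qPochInf q q) ≤ constA q z := by
    rw [constA]
    gcongr
    exact le_mul_of_one_le_left hB hP3
  have hsum : 2 * Real.pi * (N * ε) + q ^ (n - N + 1) / (1 - q) + 2 * E / qPochInf q q
      ≤ (2 * Real.pi * (N * ε) + q ^ (n - N + 1) + 2 * E) / ((1 - q) * qPochInf q q) := by
    rw [add_div, add_div]
    have hd1 : (1 - q) * qPochInf q q ≤ 1 := by nlinarith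
    have t : 0 ≤ 2 * Real.pi * (N * ε) := by positivity
    gcongr
    · exact le_div_self t hden hd1
    · exact mul_le_of_le_one_right hq.le hP1
    · exact mul_le_of_le_one_left hP0.le (by linarith)
  calc _ ≤ (2 * Real.pi * (N * ε) + q ^ (n - N + 1) + 2 * E) / ((1 - q) * qPochInf q q) *
        ramanujanB q (‖z‖ ^ 2)⁻¹ := by gcongr
    _ = ramanujanB q (‖z‖ ^ 2)⁻¹ / ((1 - q) * qPochInf q q) *
        (2 * Real.pi * (N * ε) + q ^ (n - N + 1) + 2 * E) := by ring
    _ ≤ _ := by gcongr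

lemma constA_nonneg (hq0 : 0 < q) (hq1 : q < 1) (z : ℂ) : 0 ≤ constA q z := by
  have hB := ramanujanB_nonneg hq0 hq1 (inv_nonneg.2 (sq_nonneg ‖z‖))
  have hP0 := qPochInf_pos hq0 hq1
  have hP3 := one_le_qPochInf_neg hq0 hq1 (a := q ^ 3) (by positivity)
  have hq : 0 < 1 - q := by linarith
  unfold constA
  positivity

/-- The estimates below produce only Θ/(1 - q); the remaining factors of the stated constant are
slack. -/
lemma theta_le_constTheta (hq0 : 0 < q) (hq1 : q < 1) {z : ℂ} (hz : z ≠ 0) :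
    theta (‖z‖ ^ 2) (Real.sqrt q) / (1 - q) ≤ constTheta q z := by
  have hzn : 0 < ‖z‖ := norm_pos_iff.2 hz
  have hΘ := theta_sqrt_nonneg hq0 hq1 (show 0 < ‖z‖ ^ 2 by positivity)
  have hP0 := qPochInf_pos hq0 hq1
  have hP1 := qPochInf_le_one hq0 hq1
  have hP3 := one_le_qPochInf_neg hq0 hq1 (a := q ^ 3) (by positivity)
  have hq : 0 < 1 - q := by linarith
  have hd : (1 - q) ^ 2 * qPochInf q q ≤ 1 - q := by nlinarith [mul_nonneg hq.le hq0.le]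
  unfold constTheta
  gcongr
  exact le_mul_of_one_le_left hΘ (one_le_pow₀ hP3)

/-- The case `τ = 0` with `n θ` in a fixed class modulo `1`. -/
theorem h_sinhXi_zero_of_fract (hq0 : 0 < q) (hq1 : q < 1) {z : ℂ} (hz : z ≠ 0) {θ l : ℝ} {n : ℕ}
    (hn : 2 ≤ n) {m : ℤ} (hm : (n : ℝ) * θ = m + l) :
    ∃ r : ℂ, h q n (sinhXi q 0 θ z n) / (z ^ n * (q : ℂ) ^ (-(n : ℂ) ^ 2 / 2)
        * Complex.exp (-(n : ℂ) ^ 2 * θ * Real.pi * Complex.I))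
      = ramanujanA (q : ℂ) (Complex.exp (2 * l * Real.pi * Complex.I) / z ^ 2) + r ∧
      ‖r‖ ≤ 3 * constA q z *
        (q ^ ((n : ℝ) / 2) + q ^ ((n : ℝ) ^ 2 / 4) / ‖z‖ ^ (2 * (n / 2))) := by
  have hzn : 0 < ‖z‖ := norm_pos_iff.2 hz
  have hN1 : (1 : ℝ) ≤ (n / 2 : ℕ) := by
    have : 1 ≤ n / 2 := by omega
    exact_mod_cast this
  have hN2 : (n : ℝ) ≤ 2 * (n / 2 : ℕ) + 1 := by
    have : n ≤ 2 * (n / 2) + 1 := by omega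
    exact_mod_cast this
  have hN3 : 2 * ((n / 2 : ℕ) : ℝ) ≤ n := by
    have : 2 * (n / 2) ≤ n := by omega
    exact_mod_cast this
  set E : ℝ := q ^ ((n : ℝ) ^ 2 / 4) / ‖z‖ ^ (2 * (n / 2)) with hE
  have hE0 : 0 ≤ E := by positivity
  -- With N = ⌊n/2⌋ ≥ 1 and l ≥ 1, (N + l)² - l² ≥ N² + 2N ≥ (2N + 1)²/4 ≥ n²/4, which gives E. The
  -- phase is exact, so ε = 0.
  obtain ⟨r, hr, hrn⟩ := exists_h_sinhXi_eq_ramanujanA hq0 hq1 hz (m := m) (β := l) (γ := 0)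
    (ε := 0) (N := n / 2) (by rw [hm, add_zero]) (by simp) (by omega) hE0 (fun k hk => by
      have hk' : (1 : ℝ) ≤ k := by exact_mod_cast hk
      rw [hE, inv_pow, ← pow_mul, div_eq_mul_inv, mul_right_comm]
      gcongr
      rw [← Real.rpow_natCast q (_ ^ 2), ← Real.rpow_natCast q (k ^ 2), ← Real.rpow_add hq0]
      refine Real.rpow_le_rpow_of_exponent_ge hq0 hq1.le ?_
      push_cast
      nlinarith)
  have harg : (2 * l * Real.pi * Complex.I : ℂ) = 2 * Real.pi * Complex.I * l := by ring
  refine ⟨r, by rw [hr, harg], hrn.trans ?_⟩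
  have hx : q ^ (n - n / 2 + 1) ≤ q ^ ((n : ℝ) / 2) := by
    rw [← Real.rpow_natCast]
    refine Real.rpow_le_rpow_of_exponent_ge hq0 hq1.le ?_
    have : n ≤ 2 * (n - n / 2 + 1) := by omega
    have : (n : ℝ) ≤ 2 * ((n - n / 2 + 1 : ℕ) : ℝ) := by exact_mod_cast this
    linarith
  have hx0 : 0 ≤ q ^ ((n : ℝ) / 2) := by positivity
  rw [mul_comm 3, mul_assoc (constA q z)]
  refine (mul_le_mul_of_nonneg_left ?_ (constA_nonneg hq0 hq1 z))
  rw [mul_zero, mul_zero]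
  linarith

/-- The case `τ = 0` with `n θ` close to a fixed class modulo `1`. -/
theorem h_sinhXi_zero_of_approx (hq0 : 0 < q) (hq1 : q < 1) {z : ℂ} (hz : z ≠ 0) (θ β ρ : ℝ) :
    ∃ n₀ : ℕ, ∀ n : ℕ, n₀ ≤ n → ∀ (m : ℤ) (γ : ℝ),
      (n : ℝ) * θ = m + β + γ → |γ| ≤ 1 / (n : ℝ) ^ ρ →
      ∃ r : ℂ, h q n (sinhXi q 0 θ z n) / (z ^ n * (q : ℂ) ^ (-(n : ℂ) ^ 2 / 2)
          * Complex.exp (-(n : ℂ) ^ 2 * θ * Real.pi * Complex.I))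
        = ramanujanA (q : ℂ) (Complex.exp (2 * Real.pi * Complex.I * β) / z ^ 2) + r ∧
        ‖r‖ ≤ 48 * constA q z *
          (Real.log n ^ 2 / (n : ℝ) ^ ρ + q ^ (nuLog q n ^ 2) / ‖z‖ ^ (2 * nuLog q n)) := by
  have hzn : 0 < ‖z‖ := norm_pos_iff.2 hz
  -- With ν_n ≤ n/2 the binomial defect is at most q^(n/2), which is eventually below log² n / n^ρ.
  -- The phase contributes 2π < 8 times the same quantity, well within 48.
  have hev := (eventually_nuLog_le hq0 hq1 (c := 1 / 2) (by norm_num)).and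
    (eventually_rpow_le_log_sq_div hq0 hq1 (c := 1 / 2) (by norm_num) ρ)
  obtain ⟨n₀, hn₀⟩ := eventually_atTop.1 hev
  refine ⟨n₀, fun n hn m γ hm hγ => ?_⟩
  obtain ⟨h1, h2⟩ := hn₀ n hn
  have hνn : nuLog q n ≤ n := by
    have : (nuLog q n : ℝ) ≤ n := by linarith [Nat.cast_nonneg (α := ℝ) n]
    exact_mod_cast this
  set E : ℝ := q ^ (nuLog q n ^ 2) / ‖z‖ ^ (2 * nuLog q n) with hE
  have hE0 : 0 ≤ E := by positivity
  obtain ⟨r, hr, hrn⟩ := exists_h_sinhXi_eq_ramanujanA hq0 hq1 hz hm hγ hνn hE0 (fun k _ => by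
      rw [hE, inv_pow, ← pow_mul, div_eq_mul_inv, mul_right_comm, ← pow_add]
      gcongr ?_ * _
      refine pow_le_pow_of_le_one hq0.le hq1.le ?_
      nlinarith)
  refine ⟨r, hr, hrn.trans ?_⟩
  have hx : q ^ (n - nuLog q n + 1) ≤ q ^ (1 / 2 * (n : ℝ)) := by
    rw [← Real.rpow_natCast]
    refine Real.rpow_le_rpow_of_exponent_ge hq0 hq1.le ?_
    push_cast [Nat.cast_sub hνn]
    linarith
  have hy : nuLog q n * (1 / (n : ℝ) ^ ρ) ≤ Real.log n ^ 2 / (n : ℝ) ^ ρ := by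
    rw [mul_one_div]
    gcongr
    exact nuLog_le_log_sq hq0 hq1 n
  have hy0 : 0 ≤ Real.log n ^ 2 / (n : ℝ) ^ ρ := by positivity
  have hpi := Real.pi_lt_four
  have hpi0 := Real.pi_pos
  have hz1 : 2 * Real.pi * (nuLog q n * (1 / (n : ℝ) ^ ρ))
      ≤ 8 * (Real.log n ^ 2 / (n : ℝ) ^ ρ) := by
    gcongr
    linarith
  rw [mul_comm 48, mul_assoc (constA q z)]
  refine (mul_le_mul_of_nonneg_left ?_ (constA_nonneg hq0 hq1 z))
  linarith

/-- The case `-1 < τ < 0` with `n τ` and `n θ` in fixed classes modulo `1`. -/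
theorem h_sinhXi_neg_of_fract (hq0 : 0 < q) (hq1 : q < 1) {z : ℂ} (hz : z ≠ 0) {τ : ℝ}
    (hτ : -1 < τ) (hτ' : τ < 0) (θ : ℝ) :
    ∃ n₀ : ℕ, ∀ n : ℕ, n₀ ≤ n → ∀ (m m₁ : ℤ) (l l₁ : ℝ), 0 ≤ l → l < 1 →
      -τ * n = m + l → (n : ℝ) * θ = m₁ + l₁ →
      ∃ r : ℂ, h q n (sinhXi q τ θ z n)
          = prefactor q τ θ z n m (-z ^ 2 * Complex.exp (-2 * n * θ * Real.pi * Complex.I)) *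
            (theta (-z ^ 2 * (q : ℂ) ^ ((chi m : ℂ) + l) *
              Complex.exp (-2 * l₁ * Real.pi * Complex.I)) (q : ℂ) + r) ∧
        ‖r‖ ≤ 14 * constTheta q z *
          (q ^ nuLin τ n + q ^ (nuLin τ n ^ 2) * ‖z‖ ^ (2 * nuLin τ n)
            + q ^ ((nuLin τ n : ℝ) ^ 2 / 2) / ‖z‖ ^ (2 * nuLin τ n)) := by
  have hzn : 0 < ‖z‖ := norm_pos_iff.2 hz
  have hq : 0 < 1 - q := by linarith
  have ht : Tendsto (nuLin τ) atTop atTop := by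
    refine tendsto_inf_atTop _ ?_ ?_
    · refine tendsto_nat_floor_atTop.comp (Tendsto.atTop_div_const (by norm_num) ?_)
      exact tendsto_natCast_atTop_atTop.const_mul_atTop (by linarith)
    · refine tendsto_nat_floor_atTop.comp (Tendsto.atTop_div_const (by norm_num) ?_)
      exact tendsto_natCast_atTop_atTop.const_mul_atTop (by linarith)
  obtain ⟨n₀, hn₀⟩ := eventually_atTop.1
    ((ht.eventually_ge_atTop 5).and (eventually_ge_atTop 8))
  refine ⟨n₀, fun n hn m m₁ l l₁ hl0 hl1 hm hm₁ => ?_⟩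
  obtain ⟨h5, h8⟩ := hn₀ n hn
  set N := nuLin τ n with hN
  have hnn : (0 : ℝ) ≤ n := Nat.cast_nonneg n
  have hNa : (N : ℝ) ≤ (1 + τ) * n / 4 :=
    (Nat.cast_le.2 (min_le_left _ _)).trans (Nat.floor_le (by
      have : 0 ≤ 1 + τ := by linarith
      positivity))
  have hNb : (N : ℝ) ≤ -τ * n / 4 :=
    (Nat.cast_le.2 (min_le_right _ _)).trans (Nat.floor_le (by
      have : 0 ≤ -τ := by linarith
      positivity))
  -- The quarter in the definition of μ_n leaves room on both sides of ⌊m/2⌋ for the cutoff N and an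
  -- equal margin p = N, so the binomial defect is of order q^N.
  have hm4 : 4 * (N : ℤ) ≤ m := by
    have : (4 * (N : ℤ) : ℤ) < m + 1 := by
      have : 4 * (N : ℝ) < m + 1 := by linarith
      exact_mod_cast this
    omega
  have hmn : m + 4 * N ≤ n := by
    have : (m : ℝ) + 4 * N ≤ n := by linarith
    exact_mod_cast this
  obtain ⟨r, hr, hrn⟩ := exists_h_sinhXi_eq_theta hq0 hq1 hz τ θ (N := N) (p := N) (a := 0) (b := 0)
    (ε := 0) (m := m) (m₁ := m₁) (β₂ := l₁) hl0 hl1 (by rw [hm, add_zero]) (by rw [hm₁, add_zero])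
    (by simp) (by simp) (by simp) h5 (by simp) (by omega) (by omega)
  refine ⟨r, hr, hrn.trans ?_⟩
  have hΘ := theta_sqrt_nonneg hq0 hq1 (show 0 < ‖z‖ ^ 2 by positivity)
  have hD := theta_le_constTheta hq0 hq1 hz
  set A := q ^ (N ^ 2) * ‖z‖ ^ (2 * N) with hA
  set B := q ^ ((N : ℝ) ^ 2 / 2) / ‖z‖ ^ (2 * N) with hB
  have hA0 : 0 ≤ A := by positivity
  have hB0 : 0 ≤ B := by positivity
  have hq1' : q ^ (N + 1) ≤ q ^ N := pow_le_pow_of_le_one hq0.le hq1.le (by omega)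
  have hqN : 0 ≤ q ^ N := by positivity
  have key : (q ^ 2)⁻¹ * (2 * Real.pi * (N * 0) * (1 + Real.log q⁻¹)) + 2 * q ^ (N + 1) / (1 - q)
      + 2 * (‖z‖ ^ (2 * N) * q ^ (N ^ 2)) + 2 * B ≤ 14 * (q ^ N + A + B) / (1 - q) := by
    rw [mul_comm (‖z‖ ^ (2 * N)), ← hA, le_div_iff₀ hq]
    have e : ((q ^ 2)⁻¹ * (2 * Real.pi * (N * 0) * (1 + Real.log q⁻¹)) +
        2 * q ^ (N + 1) / (1 - q) + 2 * A + 2 * B) * (1 - q)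
        = 2 * q ^ (N + 1) + (2 * A + 2 * B) * (1 - q) := by
      field_simp
      ring
    rw [e]
    nlinarith [mul_nonneg hA0 hq0.le, mul_nonneg hB0 hq0.le]
  calc _ ≤ 14 * (q ^ N + A + B) / (1 - q) * theta (‖z‖ ^ 2) (Real.sqrt q) := by gcongr
    _ = 14 * (theta (‖z‖ ^ 2) (Real.sqrt q) / (1 - q)) * (q ^ N + A + B) := by ring
    _ ≤ _ := by gcongr

/-- The case `-1 < τ < 0` with `-n τ` and `n θ` close to fixed classes modulo `1`. -/
theorem h_sinhXi_neg_of_approx (hq0 : 0 < q) (hq1 : q < 1) {z : ℂ} (hz : z ≠ 0) {τ : ℝ}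
    (hτ : -1 < τ) (hτ' : τ < 0) (θ : ℝ) {ρ : ℝ} (hρ : 0 < ρ) :
    ∃ n₀ : ℕ, ∀ n : ℕ, n₀ ≤ n → ∀ (m m₁ : ℤ) (β₁ β₂ a b : ℝ), 0 ≤ β₁ → β₁ < 1 →
      -τ * n = m + β₁ + a → |a| ≤ 1 / (n : ℝ) ^ ρ →
      (n : ℝ) * θ = m₁ + β₂ + b → |b| ≤ 1 / (n : ℝ) ^ ρ →
      ∃ r : ℂ, h q n (sinhXi q τ θ z n)
          = prefactor q τ θ z n m (-z ^ 2 * Complex.exp (-2 * n * θ * Real.pi * Complex.I)) *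
            (theta (-z ^ 2 * (q : ℂ) ^ ((chi m : ℂ) + β₁) *
              Complex.exp (-2 * β₂ * Real.pi * Complex.I)) (q : ℂ) + r) ∧
        ‖r‖ ≤ errTheta q z ρ n := by
  have hzn : 0 < ‖z‖ := norm_pos_iff.2 hz
  have hq : 0 < 1 - q := by linarith
  have hl : 0 < Real.log q⁻¹ := Real.log_pos ((one_lt_inv₀ hq0).2 hq1)
  -- Cutoff and margin each take at most cn, whereas m ≥ 8cn - 2 and m ≤ n - 8cn + 1. The
  -- constraints on ⌊m/2⌋ therefore hold once cn ≥ 8.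
  obtain ⟨c, hc0, hc1, hc2⟩ : ∃ c : ℝ, 0 < c ∧ 8 * c ≤ -τ ∧ 8 * c ≤ 1 + τ := by
    refine ⟨min (-τ) (1 + τ) / 8, ?_, ?_, ?_⟩
    · have : 0 < min (-τ) (1 + τ) := lt_min (by linarith) (by linarith)
      positivity
    · linarith [min_le_left (-τ) (1 + τ)]
    · linarith [min_le_right (-τ) (1 + τ)]
  have hcn : ∀ᶠ n : ℕ in atTop, 8 ≤ c * (n : ℝ) :=
    (tendsto_natCast_atTop_atTop.const_mul_atTop hc0).eventually_ge_atTop 8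
  obtain ⟨n₀, hn₀⟩ := eventually_atTop.1
    ((((((tendsto_nuLog hq0 hq1).eventually_ge_atTop 5).and (eventually_nuLog_le hq0 hq1 hc0)).and
      (eventually_rpow_le_log_sq_div hq0 hq1 hc0 ρ)).and (eventually_nuLog_mul_le hq0 hq1 hρ)).and
      ((eventually_one_div_rpow_le_one hρ).and hcn))
  refine ⟨n₀, fun n hn m m₁ β₁ β₂ a b hβ0 hβ1 hm ha hm₁ hb => ?_⟩
  obtain ⟨⟨⟨⟨h5, hνc⟩, hexp⟩, hνl⟩, hone, h8⟩ := hn₀ n hn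
  set N := nuLog q n with hN
  set p := ⌊c * (n : ℝ)⌋₊ with hp
  have hp1 : (p : ℝ) ≤ c * n := Nat.floor_le (by positivity)
  have hp2 : c * n < (p : ℝ) + 1 := Nat.lt_floor_add_one _
  obtain ⟨ha1, ha2⟩ := abs_le.1 (ha.trans hone)
  have hcτ : 8 * (c * n) ≤ -τ * n := by
    rw [← mul_assoc]
    gcongr
  have hcτ' : 8 * (c * n) ≤ n + τ * n := by
    have : 8 * c * n ≤ (1 + τ) * n := by gcongr
    linarith
  have hM1 : 2 * (N + p : ℤ) + 4 ≤ m := by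
    have : 2 * ((N : ℝ) + p) + 4 ≤ m := by linarith
    exact_mod_cast this
  have hM2 : m + 2 * N + 2 * p + 4 ≤ n := by
    have : (m : ℝ) + 2 * N + 2 * p + 4 ≤ n := by linarith
    exact_mod_cast this
  obtain ⟨r, hr, hrn⟩ := exists_h_sinhXi_eq_theta hq0 hq1 hz τ θ (N := N) (p := p) (m := m)
    (m₁ := m₁) (β₂ := β₂) hβ0 hβ1 hm hm₁ (ha.trans hone) ha hb h5 hνl (by omega) (by omega)
  refine ⟨r, hr, hrn.trans ?_⟩
  have hΘ := theta_sqrt_nonneg hq0 hq1 (show 0 < ‖z‖ ^ 2 by positivity)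
  have hD := theta_le_constTheta hq0 hq1 hz
  unfold errTheta
  rw [← hN]
  set A := ‖z‖ ^ (2 * N) * q ^ (N ^ 2) with hA
  set B := q ^ ((N : ℝ) ^ 2 / 2) / ‖z‖ ^ (2 * N) with hB
  set X := Real.log n ^ 2 / (n : ℝ) ^ ρ with hX
  have hA0 : 0 ≤ A := by positivity
  have hB0 : 0 ≤ B := by positivity
  have hX0 : 0 ≤ X := by positivity
  have hq1' : q ^ (p + 1) ≤ X := by
    refine le_trans ?_ hexp
    rw [← Real.rpow_natCast]
    refine Real.rpow_le_rpow_of_exponent_ge hq0 hq1.le ?_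
    push_cast
    exact hp2.le
  have hK : (q ^ 2)⁻¹ * (2 * Real.pi * (N * (1 / (n : ℝ) ^ ρ)) * (1 + Real.log q⁻¹)) ≤ 8 * X := by
    have h1 : (N : ℝ) * (1 + Real.log q⁻¹) ≤ q ^ 2 * Real.log n ^ 2 := by
      refine (nuLog_le hq0 hq1 n).trans ?_
      gcongr ?_ * _
      exact pow_le_pow_of_le_one hq0.le hq1.le (by norm_num)
    have h2 : (q ^ 2)⁻¹ * (2 * Real.pi * (N * (1 / (n : ℝ) ^ ρ)) * (1 + Real.log q⁻¹))
        = 2 * Real.pi * ((q ^ 2)⁻¹ * (N * (1 + Real.log q⁻¹)) * (1 / (n : ℝ) ^ ρ)) := by ring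
    have h3 : (q ^ 2)⁻¹ * (N * (1 + Real.log q⁻¹)) * (1 / (n : ℝ) ^ ρ) ≤ X := by
      rw [hX, ← mul_one_div (Real.log n ^ 2)]
      gcongr
      rw [inv_mul_le_iff₀ (by positivity)]
      exact h1
    have hpi := Real.pi_lt_four
    have hpi0 := Real.pi_pos
    rw [h2]
    calc _ ≤ 2 * Real.pi * X := by gcongr
      _ ≤ _ := by nlinarith
  -- The perturbation gives 8X, the binomial defect 2X/(1 - q), and the tails 2A + 2B; all fit under
  -- 62 after division by 1 - q < 1.
  have key : (q ^ 2)⁻¹ * (2 * Real.pi * (N * (1 / (n : ℝ) ^ ρ)) * (1 + Real.log q⁻¹)) +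
      2 * q ^ (p + 1) / (1 - q) + 2 * A + 2 * B ≤ 62 * (A + B + X) / (1 - q) := by
    have h1 : 2 * q ^ (p + 1) / (1 - q) ≤ 2 * X / (1 - q) := by gcongr
    have h2 : ∀ x : ℝ, 0 ≤ x → x ≤ x / (1 - q) := fun x hx => le_div_self hx hq (by linarith)
    have h3 := h2 (8 * X) (by positivity)
    have h4 := h2 (2 * A) (by positivity)
    have h5 := h2 (2 * B) (by positivity)
    calc _ ≤ 8 * X / (1 - q) + 2 * X / (1 - q) + 2 * A / (1 - q) + 2 * B / (1 - q) := by linarith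
      _ = (8 * X + 2 * X + 2 * A + 2 * B) / (1 - q) := by ring
      _ ≤ _ := by
        gcongr
        linarith
  calc _ ≤ 62 * (A + B + X) / (1 - q) * theta (‖z‖ ^ 2) (Real.sqrt q) := by gcongr
    _ = 62 * (theta (‖z‖ ^ 2) (Real.sqrt q) / (1 - q)) * (A + B + X) := by ring
    _ ≤ _ := by gcongr

end Main

lemma exp_neg_two_pi_eq {x l : ℝ} {m : ℤ} (h : x = m + l) :
    Complex.exp (-2 * x * Real.pi * Complex.I) = Complex.exp (-2 * Real.pi * Complex.I * l) := by
  rw [Complex.exp_eq_exp_iff_exists_int]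
  refine ⟨-m, ?_⟩
  rw [h]
  push_cast
  ring

end IsmailMasson

end

/-! ### Assembly of the seven cases -/

open IsmailMasson in
theorem theorem3p1 (q : ℝ) (hq0 : 0 < q) (hq1 : q < 1) (z : ℂ) (hz : z ≠ 0) (τ θ : ℝ) :
    -- (1) `τ > 0`
    (0 < τ → ∀ n : ℕ, ∃ r : ℂ,
      h q n (sinhXi q τ θ z n) / (z ^ n * (q : ℂ) ^ (-(n : ℂ) ^ 2 * scal q τ θ)) = 1 + r ∧
      ‖r‖ ≤ q * ramanujanB q (q ^ 2 * (‖z‖ ^ 2)⁻¹) / ((1 - q) * ‖z‖ ^ 2) * q ^ ((n : ℝ) * τ)) ∧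
    -- (2) `τ = 0` and `θ` rational
    (τ = 0 → θ ∈ Set.range ((↑) : ℚ → ℝ) → ∀ l ∈ fracSet θ,
      {n : ℕ | 0 < n ∧ ∃ m : ℤ, (n : ℝ) * θ = m + l ∧ l = Int.fract ((n : ℝ) * θ)}.Infinite ∧
      ∃ n₀ : ℕ, ∀ n : ℕ, n₀ ≤ n → 0 < n → ∀ m : ℤ,
        (n : ℝ) * θ = m + l → l = Int.fract ((n : ℝ) * θ) →
        ∃ r : ℂ,
          h q n (sinhXi q τ θ z n) /
              (z ^ n * (q : ℂ) ^ (-(n : ℂ) ^ 2 / 2)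
                * Complex.exp (-(n : ℂ) ^ 2 * θ * Real.pi * Complex.I))
            = ramanujanA (q : ℂ) (Complex.exp (2 * l * Real.pi * Complex.I) / z ^ 2) + r ∧
          ‖r‖ ≤ 3 * constA q z *
            (q ^ ((n : ℝ) / 2) + q ^ ((n : ℝ) ^ 2 / 4) / ‖z‖ ^ (2 * (n / 2)))) ∧
    -- (3) `τ = 0` and `θ` irrational
    (τ = 0 → Irrational θ → ∀ β ρ : ℝ, 0 < ρ → (ρ : EReal) < irrMeasure ![θ] ![β] - 1 →
      {n : ℕ | 0 < n ∧ ∃ m : ℤ, ∃ γ : ℝ,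
        (n : ℝ) * θ = m + β + γ ∧ |γ| ≤ 1 / (n : ℝ) ^ ρ}.Infinite ∧
      ∃ n₀ : ℕ, ∀ n : ℕ, n₀ ≤ n → 0 < n → ∀ (m : ℤ) (γ : ℝ),
        (n : ℝ) * θ = m + β + γ → |γ| ≤ 1 / (n : ℝ) ^ ρ →
        ∃ r : ℂ,
          h q n (sinhXi q τ θ z n) /
              (z ^ n * (q : ℂ) ^ (-(n : ℂ) ^ 2 / 2)
                * Complex.exp (-(n : ℂ) ^ 2 * θ * Real.pi * Complex.I))
            = ramanujanA (q : ℂ) (Complex.exp (2 * Real.pi * Complex.I * β) / z ^ 2) + r ∧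
          ‖r‖ ≤ 48 * constA q z *
            (Real.log n ^ 2 / (n : ℝ) ^ ρ + q ^ (nuLog q n ^ 2) / ‖z‖ ^ (2 * nuLog q n))) ∧
    -- (4) `-1 < τ < 0`, both `τ` and `θ` rational
    (-1 < τ → τ < 0 → τ ∈ Set.range ((↑) : ℚ → ℝ) → θ ∈ Set.range ((↑) : ℚ → ℝ) →
      ∀ l ∈ fracSet (-τ), ∀ l₁ ∈ fracSet θ,
      {n : ℕ | 0 < n ∧ l = Int.fract (-τ * n) ∧ l₁ = Int.fract ((n : ℝ) * θ)}.Infinite →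
      ∃ n₀ : ℕ, ∀ n : ℕ, n₀ ≤ n → 0 < n → ∀ m m₁ : ℤ,
        -(n : ℝ) * τ = m + l → m = ⌊-τ * n⌋ → l = Int.fract (-τ * n) →
        (n : ℝ) * θ = m₁ + l₁ → l₁ = Int.fract ((n : ℝ) * θ) →
        ∃ r : ℂ,
          h q n (sinhXi q τ θ z n)
            = prefactor q τ θ z n m (-z ^ 2 * Complex.exp (-2 * Real.pi * Complex.I * l₁)) *
              (theta (-z ^ 2 * (q : ℂ) ^ ((chi m : ℂ) + l)
                * Complex.exp (-2 * Real.pi * Complex.I * l₁)) (q : ℂ) + r) ∧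
          ‖r‖ ≤ 14 * constTheta q z *
            (q ^ nuLin τ n + q ^ (nuLin τ n ^ 2) * ‖z‖ ^ (2 * nuLin τ n)
              + q ^ ((nuLin τ n : ℝ) ^ 2 / 2) / ‖z‖ ^ (2 * nuLin τ n))) ∧
    -- (5) `-1 < τ < 0`, `τ` rational and `θ` irrational
    (-1 < τ → τ < 0 → τ ∈ Set.range ((↑) : ℚ → ℝ) → Irrational θ →
      ∀ β ρ : ℝ, 0 ≤ β → β < 1 → 0 < ρ → (ρ : EReal) < irrMeasure ![θ] ![β] - 1 →
      (∃ l ∈ fracSet (-τ), {n : ℕ | 0 < n ∧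
        (∃ m₁ : ℤ, ∃ b : ℝ, (n : ℝ) * θ = m₁ + β + b ∧ |b| ≤ 1 / (n : ℝ) ^ ρ) ∧
        -(n : ℝ) * τ = ⌊-(n : ℝ) * τ⌋ + l}.Infinite) ∧
      ∀ l ∈ fracSet (-τ), ∃ n₀ : ℕ, ∀ n : ℕ, n₀ ≤ n → 0 < n → ∀ (m m₁ : ℤ) (b : ℝ),
        (n : ℝ) * θ = m₁ + β + b → |b| ≤ 1 / (n : ℝ) ^ ρ →
        -(n : ℝ) * τ = m + l → m = ⌊-(n : ℝ) * τ⌋ →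
        ∃ r : ℂ,
          h q n (sinhXi q τ θ z n)
            = prefactor q τ θ z n m
                (-z ^ 2 * Complex.exp (-2 * n * θ * Real.pi * Complex.I)) *
              (theta (-z ^ 2 * (q : ℂ) ^ ((chi m : ℂ) + l)
                * Complex.exp (-2 * β * Real.pi * Complex.I)) (q : ℂ) + r) ∧
          ‖r‖ ≤ errTheta q z ρ n) ∧
    -- (6) `-1 < τ < 0`, `τ` irrational and `θ` rational
    (-1 < τ → τ < 0 → Irrational τ → θ ∈ Set.range ((↑) : ℚ → ℝ) →
      ∀ β ρ : ℝ, 0 ≤ β → β < 1 → 0 < ρ → (ρ : EReal) < irrMeasure ![-τ] ![β] - 1 →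
      (∃ l ∈ fracSet θ, {n : ℕ | 0 < n ∧
        (∃ m : ℤ, ∃ a : ℝ, -(n : ℝ) * τ = m + β + a ∧ |a| ≤ 1 / (n : ℝ) ^ ρ) ∧
        l = Int.fract ((n : ℝ) * θ)}.Infinite) ∧
      ∀ l ∈ fracSet θ, ∃ n₀ : ℕ, ∀ n : ℕ, n₀ ≤ n → 0 < n → ∀ (m m₁ : ℤ) (a : ℝ),
        -(n : ℝ) * τ = m + β + a → |a| ≤ 1 / (n : ℝ) ^ ρ →
        (n : ℝ) * θ = m₁ + l → l = Int.fract ((n : ℝ) * θ) →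
        ∃ r : ℂ,
          h q n (sinhXi q τ θ z n)
            = prefactor q τ θ z n m
                (-z ^ 2 * Complex.exp (-2 * n * θ * Real.pi * Complex.I)) *
              (theta (-z ^ 2 * (q : ℂ) ^ ((chi m : ℂ) + β)
                * Complex.exp (-2 * l * Real.pi * Complex.I)) (q : ℂ) + r) ∧
          ‖r‖ ≤ errTheta q z ρ n) ∧
    -- (7) `-1 < τ < 0`, both `τ` and `θ` irrational
    (-1 < τ → τ < 0 → Irrational τ → Irrational θ →
      ∀ β₁ β₂ : ℝ, 0 ≤ β₁ → β₁ < 1 → 0 ≤ β₂ → β₂ < 1 →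
      1 < irrMeasure ![-τ, θ] ![β₁, β₂] →
      ∀ ρ : ℝ, 0 < ρ → (ρ : EReal) < irrMeasure ![-τ, θ] ![β₁, β₂] - 1 →
      {n : ℕ | 0 < n ∧ ∃ m m₁ : ℤ, ∃ a b : ℝ,
        -τ * n = m + β₁ + a ∧ |a| < 1 / (n : ℝ) ^ ρ ∧
        (n : ℝ) * θ = m₁ + β₂ + b ∧ |b| < 1 / (n : ℝ) ^ ρ}.Infinite ∧
      ∃ n₀ : ℕ, ∀ n : ℕ, n₀ ≤ n → 0 < n → ∀ (m m₁ : ℤ) (a b : ℝ),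
        -τ * n = m + β₁ + a → |a| < 1 / (n : ℝ) ^ ρ →
        (n : ℝ) * θ = m₁ + β₂ + b → |b| < 1 / (n : ℝ) ^ ρ →
        ∃ r : ℂ,
          h q n (sinhXi q τ θ z n)
            = prefactor q τ θ z n m
                (-z ^ 2 * Complex.exp (-2 * n * θ * Real.pi * Complex.I)) *
              (theta (-z ^ 2 * (q : ℂ) ^ ((chi m : ℂ) + β₁)
                * Complex.exp (-2 * β₂ * Real.pi * Complex.I)) (q : ℂ) + r) ∧
          ‖r‖ ≤ errTheta q z ρ n) := by
  refine ⟨fun hτ n => h_sinhXi_of_pos hq0 hq1 hz hτ θ n, ?_, ?_, ?_, ?_, ?_, ?_⟩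
  · rintro rfl hθ l hl
    refine ⟨(infinite_fract_eq hθ hl).mono ?_, 2, fun n hn _ m hm _ =>
      h_sinhXi_zero_of_fract hq0 hq1 hz hn hm⟩
    rintro n ⟨hn, hln⟩
    exact ⟨hn, ⌊(n : ℝ) * θ⌋, by rw [hln, Int.floor_add_fract], hln⟩
  · rintro rfl hθ β ρ hρ hω
    refine ⟨(infinite_of_lt_irrMeasure_sub_one hρ hω).mono ?_, ?_⟩
    · rintro n ⟨hn, hj⟩
      obtain ⟨m, hm⟩ := hj 0
      exact ⟨hn, m, (n : ℝ) * θ - β - m, by ring, by simpa using hm.le⟩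
    · obtain ⟨n₀, hn₀⟩ := h_sinhXi_zero_of_approx hq0 hq1 hz θ β ρ
      exact ⟨n₀, fun n hn _ m γ => hn₀ n hn m γ⟩
  · intro hτ hτ' _ _ l hl l₁ _ _
    obtain ⟨n₀, hn₀⟩ := h_sinhXi_neg_of_fract hq0 hq1 hz hτ hτ' θ
    refine ⟨n₀, fun n hn _ m m₁ hm _ _ hm₁ _ => ?_⟩
    obtain ⟨hl0, hl1⟩ := fracSet_mem_Ico hl
    obtain ⟨r, hr, hrn⟩ := hn₀ n hn m m₁ l l₁ hl0 hl1 (by rw [← hm]; ring) hm₁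
    refine ⟨r, ?_, hrn⟩
    -- As nθ - λ₁ is an integer, the phase in the prefactor may be written with λ₁.
    have e1 : Complex.exp (-2 * n * θ * Real.pi * Complex.I)
        = Complex.exp (-2 * Real.pi * Complex.I * l₁) := by
      rw [← exp_neg_two_pi_eq hm₁]
      push_cast
      congr 1
      ring
    have e2 : Complex.exp (-2 * l₁ * Real.pi * Complex.I)
        = Complex.exp (-2 * Real.pi * Complex.I * l₁) := by
      congr 1
      ring
    rw [hr, e1, e2]
  · intro hτ hτ' hτr _ β ρ _ _ hρ hω
    refine ⟨?_, fun l hl => ?_⟩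
    · obtain ⟨l, hl, hinf⟩ := exists_infinite_fract_eq (mem_range_neg hτr)
        (infinite_of_lt_irrMeasure_sub_one hρ hω)
      refine ⟨l, hl, hinf.mono ?_⟩
      rintro n ⟨⟨hn, hj⟩, hln⟩
      obtain ⟨m, hm⟩ := hj 0
      refine ⟨hn, ⟨m, (n : ℝ) * θ - β - m, by ring, by simpa using hm.le⟩, ?_⟩
      rw [hln, ← neg_mul_comm, Int.floor_add_fract]
    · obtain ⟨n₀, hn₀⟩ := h_sinhXi_neg_of_approx hq0 hq1 hz hτ hτ' θ hρ
      obtain ⟨hl0, hl1⟩ := fracSet_mem_Ico hl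
      -- The rational coordinate is a special case of approximation, with error 0.
      exact ⟨n₀, fun n hn _ m m₁ b hb hbn hm _ => hn₀ n hn m m₁ l β 0 b hl0 hl1
        (by rw [add_zero, ← hm]; ring) (by rw [abs_zero]; positivity) hb hbn⟩
  · intro hτ hτ' _ hθ β ρ hβ0 hβ1 hρ hω
    refine ⟨?_, fun l hl => ?_⟩
    · obtain ⟨l, hl, hinf⟩ := exists_infinite_fract_eq hθ
        (infinite_of_lt_irrMeasure_sub_one hρ hω)
      refine ⟨l, hl, hinf.mono ?_⟩
      rintro n ⟨⟨hn, hj⟩, hln⟩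
      obtain ⟨m, hm⟩ := hj 0
      exact ⟨hn, ⟨m, -(n : ℝ) * τ - β - m, by ring, by simpa using hm.le⟩, hln⟩
    · obtain ⟨n₀, hn₀⟩ := h_sinhXi_neg_of_approx hq0 hq1 hz hτ hτ' θ hρ
      exact ⟨n₀, fun n hn _ m m₁ a ha han hm _ => hn₀ n hn m m₁ β l a 0 hβ0 hβ1
        (by rw [← ha]; ring) han (by rw [hm, add_zero]) (by rw [abs_zero]; positivity)⟩
  · intro hτ hτ' _ _ β₁ β₂ hβ0 hβ1 _ _ _ ρ hρ hω
    refine ⟨(infinite_of_lt_irrMeasure_sub_one hρ hω).mono ?_, ?_⟩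
    · rintro n ⟨hn, hj⟩
      obtain ⟨m, hm⟩ := hj 0
      obtain ⟨m₁, hm₁⟩ := hj 1
      exact ⟨hn, m, m₁, -τ * n - β₁ - m, (n : ℝ) * θ - β₂ - m₁, by ring,
        by simpa [mul_comm] using hm, by ring, by simpa using hm₁⟩
    · obtain ⟨n₀, hn₀⟩ := h_sinhXi_neg_of_approx hq0 hq1 hz hτ hτ' θ hρ
      exact ⟨n₀, fun n hn _ m m₁ a b ha han hb hbn =>
        hn₀ n hn m m₁ β₁ β₂ a b hβ0 hβ1 ha han.le hb hbn.le⟩
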